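/- Let $G=(V,E)$ be a finite simple graph and let $n\ge 1$ be a number of agents. The cut-value of $S\subseteq V$ is $v(S)=|\{(o,o')\in E: o\in S,\ o'\in V\setminus S\}|$, the number of edges with exactly one endpoint in $S$; all agents value bundles of vertices by $v$. An allocation $A=(A_1,\dots,A_n)$ consists of pairwise disjoint subsets of $V$; it is complete if $\bigcup_i A_i=V$. It is EF1 (envy-free up to one item) if for all agents $i,j$ with $v(A_j)>v(A_i)$ there is $o\in A_j$ with $v(A_i)\ge v(A_j\setminus\{o\})$. A complete allocation $A$ is socially optimal (SO) if $\sum_i v(A_i)\ge\sum_i v(B_i)$ for every complete allocation $B$ (bundles may be empty). Theorem. If $G$ is a forest (acyclic, possibly disconnected), then there is a complete allocation of $V$ to the $n$ agents that is both EF1 and SO, and, if $n\le |V|$, all of whose bundles are non-empty. Moreover, such an allocation can be computed in polynomial time: there are a single random access machine program (each elementary operation, namely copying, addition, truncated subtraction, zero test, or array access, has unit cost) and a polynomial $p$ such that, for all $n\ge1$ and $m\ge 0$, every forest $G$ on the vertex set $\{0,\dots,m-1\}$, and every list of the edges of $G$ (each edge once, in any order and orientation), the program, given $n$, $m$ and the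 list, halts after at most $p(m)$ steps and outputs, for each vertex, the agent who receives it, in a complete allocation that is EF1 and SO, and has no empty bundle if $n\le m$. -/

import Mathlib

/-! ## Cut-valuations and allocations -/

namespace CutDivision

/-- The cut-value `v(S)`: the number of edges with one endpoint in `S` and the other in `V \ S`.
Each such edge is counted once, as the pair (endpoint in `S`, endpoint outside `S`). -/
def cutValue {V : Type*} [Fintype V] [DecidableEq V] (G : SimpleGraph V) [DecidableRel G.Adj]
    (S : Finset V) : ℕ :=
  (G.interedges S Sᶜ).card

/-- A (possibly partial) allocation of the items `V` to the agents `Fin n`: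
pairwise disjoint bundles, one for each agent. -/
structure Allocation (V : Type*) (n : ℕ) where
  /-- the bundle of each agent -/
  bundle : Fin n → Finset V
  /-- distinct agents get disjoint bundles -/
  disjoint : ∀ i j, i ≠ j → Disjoint (bundle i) (bundle j)

namespace Allocation

/-- Every item is allocated. -/
def IsComplete {V : Type*} {n : ℕ} (A : Allocation V n) : Prop :=
  ∀ o : V, ∃ i, o ∈ A.bundle i

/-- Every agent receives at least one item. -/
def IsNonempty {V : Type*} {n : ℕ} (A : Allocation V n) : Prop :=
  ∀ i, (A.bundle i).Nonempty

/-- Envy-freeness up to one item with respect to the cut-valuation of `G`. -/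
def IsEF1 {V : Type*} [Fintype V] [DecidableEq V] {n : ℕ} (A : Allocation V n)
    (G : SimpleGraph V) [DecidableRel G.Adj] : Prop :=
  ∀ i j, cutValue G (A.bundle i) < cutValue G (A.bundle j) →
    ∃ o ∈ A.bundle j, cutValue G (A.bundle j \ {o}) ≤ cutValue G (A.bundle i)

/-- Utilitarian social welfare. -/
def welfare {V : Type*} [Fintype V] [DecidableEq V] {n : ℕ} (A : Allocation V n)
    (G : SimpleGraph V) [DecidableRel G.Adj] : ℕ :=
  ∑ i, cutValue G (A.bundle i)

/-- `A` maximizes the utilitarian social welfare among all complete allocations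
(bundles of the competing allocations may be empty). -/
def IsSociallyOptimal {V : Type*} [Fintype V] [DecidableEq V] {n : ℕ} (A : Allocation V n)
    (G : SimpleGraph V) [DecidableRel G.Adj] : Prop :=
  A.IsComplete ∧ ∀ B : Allocation V n, B.IsComplete → B.welfare G ≤ A.welfare G

end Allocation

end CutDivision

/-! ## Random access machines with a step count

Programs over natural-number registers and finitely many random-access arrays.
The only arithmetic is addition and truncated subtraction, so that after `t` steps
every stored number has at most `O(t)` bits more than the numbers in the input:
polynomially many steps here are polynomially many steps of a Turing machine. -/

namespace RAM

/-- A memory: scalar registers and arrays, both indexed by names in `ℕ`.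
(A fixed program mentions only finitely many names.) -/
structure Mem where
  /-- contents of the scalar registers -/
  var : ℕ → ℕ
  /-- contents of the arrays: name, then index -/
  arr : ℕ → ℕ → ℕ

/-- Expressions. -/
inductive Expr where
  /-- a constant -/
  | lit (k : ℕ)
  /-- the register `x` -/
  | var (x : ℕ)
  /-- the entry of the array `a` at a computed index -/
  | get (a : ℕ) (i : Expr)
  /-- addition -/
  | add (e f : Expr)
  /-- truncated subtraction -/
  | sub (e f : Expr)

/-- The value of an expression. -/
def Expr.eval : Expr → Mem → ℕ
  | .lit k, _ => k
  | .var x, s => s.var x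
  | .get a i, s => s.arr a (i.eval s)
  | .add e f, s => e.eval s + f.eval s
  | .sub e f, s => e.eval s - f.eval s

/-- The cost of evaluating an expression: one step for each of its nodes. -/
def Expr.cost : Expr → ℕ
  | .lit _ => 1
  | .var _ => 1
  | .get _ i => i.cost + 1
  | .add e f => e.cost + f.cost + 1
  | .sub e f => e.cost + f.cost + 1

/-- Programs. A test succeeds if its value is nonzero. -/
inductive Program where
  /-- do nothing -/
  | skip
  /-- `x := e` -/
  | assign (x : ℕ) (e : Expr)
  /-- `a[i] := e` -/
  | store (a : ℕ) (i e : Expr)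
  /-- first `c`, then `d` -/
  | seq (c d : Program)
  /-- if `e ≠ 0` then `c` else `d` -/
  | branch (e : Expr) (c d : Program)
  /-- while `e ≠ 0` do `c` -/
  | loop (e : Expr) (c : Program)

/-- `Exec c s s' t`: the program `c`, started with memory `s`, halts with memory `s'`
after exactly `t` steps. -/
inductive Exec : Program → Mem → Mem → ℕ → Prop where
  | skip (s : Mem) : Exec .skip s s 1
  | assign (x : ℕ) (e : Expr) (s : Mem) :
      Exec (.assign x e) s { s with var := Function.update s.var x (e.eval s) } (e.cost + 1)
  | store (a : ℕ) (i e : Expr) (s : Mem) :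
      Exec (.store a i e) s
        { s with arr := Function.update s.arr a
                          (Function.update (s.arr a) (i.eval s) (e.eval s)) }
        (i.cost + e.cost + 1)
  | seq {c d : Program} {s s' s'' : Mem} {t t' : ℕ} :
      Exec c s s' t → Exec d s' s'' t' → Exec (.seq c d) s s'' (t + t')
  | branch_true {e : Expr} {c d : Program} {s s' : Mem} {t : ℕ} :
      e.eval s ≠ 0 → Exec c s s' t → Exec (.branch e c d) s s' (e.cost + 1 + t)
  | branch_false {e : Expr} {c d : Program} {s s' : Mem} {t : ℕ} :
      e.eval s = 0 → Exec d s s' t → Exec (.branch e c d) s s' (e.cost + 1 + t)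
  | loop_true {e : Expr} {c : Program} {s s' s'' : Mem} {t t' : ℕ} :
      e.eval s ≠ 0 → Exec c s s' t → Exec (.loop e c) s' s'' t' →
        Exec (.loop e c) s s'' (e.cost + 1 + t + t')
  | loop_false {e : Expr} {c : Program} {s : Mem} :
      e.eval s = 0 → Exec (.loop e c) s s (e.cost + 1)

end RAM

/-! ## Instances as inputs, allocations as outputs -/

namespace CutDivision

/-- `L` lists every edge of `G` exactly once, in any order and in either orientation. -/
def IsEdgeList {m : ℕ} (G : SimpleGraph (Fin m)) (L : List (Fin m × Fin m)) : Prop :=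
  (L.map fun e => s(e.1, e.2)).Nodup ∧ ∀ e, e ∈ (L.map fun e => s(e.1, e.2)) ↔ e ∈ G.edgeSet

/-- The initial memory for `n` agents and a graph on `Fin m` with edge list `L`:
registers 0, 1, 2 hold `n`, `m` and the number of edges, and the `k`-th entries of the arrays
0 and 1 are the two endpoints of the `k`-th edge. Everything else is zero. -/
def inputMem (n m : ℕ) (L : List (Fin m × Fin m)) : RAM.Mem where
  var x := if x = 0 then n else if x = 1 then m else if x = 2 then L.length else 0
  arr a k :=
    if a = 0 then (L.map fun e => (e.1 : ℕ)).getD k 0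
    else if a = 1 then (L.map fun e => (e.2 : ℕ)).getD k 0
    else 0

/-- The final memory `s` represents the allocation `A`: the array 2 holds, at index `o`,
the number of the agent who gets the item `o` (any number outside `Fin n` if nobody does). -/
def Outputs {m n : ℕ} (s : RAM.Mem) (A : Allocation (Fin m) n) : Prop :=
  ∀ (i : Fin n) (o : Fin m), o ∈ A.bundle i ↔ s.arr 2 o = i

end CutDivision

namespace CutDivision

open Finset

/-! ## Partial colourings -/

section Coloring

variable {V : Type*} [Fintype V] [DecidableEq V] (G : SimpleGraph V) [DecidableRel G.Adj]

/-! Use the agents as colours. Each edge contributes to at most two bundles, and a proper colouring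
attains this for every edge, so it is socially optimal (`welfare_le`). The value of a bundle is then
the sum of its degrees, and removing `o` lowers it by at least `deg G o`. It remains to colour a
forest properly with degree sums balanced up to one vertex.

Vertices are coloured one by one, each joining a class of minimal degree sum; this preserves EF1,
since without the new vertex that class is a poorest one again. The coloured part stays path-convex,
so an uncoloured vertex has at most one coloured neighbour, and properness can fail only if this
neighbour lies in the chosen class `k`. Hence the new vertex is taken next to another class, the one
with the most open edges (edges to uncoloured vertices). If no class has an open edge, any
uncoloured vertex starts a new component. The critical case is that only `k` has open edges: the
vertex must then join a second poorest class, and the invariant `bal` ensures that this class ties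
with `k`. To preserve `bal`, ties between poorest classes are broken by open degree; counting
emptiness as well keeps the bundles non-empty. The three cases are `GreedyInv.step_attach`,
`GreedyInv.root` and `GreedyInv.step_swap`.

For the complexity claim the greedy algorithm is written with `for` loops whose bounds are never
overwritten, which yields a polynomial time bound by recursion on the program (`compile_exec`). The
case `m ≤ n` is treated apart, to bound the time in `m` alone. -/

/-- The number of edges at `v`. -/
def deg (v : V) : ℕ := ∑ y, if G.Adj v y then 1 else 0

/-- The sum of the degrees of the vertices of colour `c`. -/
def classDeg (col : V → ℕ) (c : ℕ) : ℕ := ∑ x, ∑ y, if G.Adj x y ∧ col x = c then 1 else 0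

/-- The number of edges from vertices of colour `c` to uncoloured vertices (those of colour `n`). -/
def openDeg (n : ℕ) (col : V → ℕ) (c : ℕ) : ℕ :=
  ∑ x, ∑ y, if G.Adj x y ∧ col x = c ∧ col y = n then 1 else 0

/-- The total number of edges between coloured and uncoloured vertices. -/
def openTotal (n : ℕ) (col : V → ℕ) : ℕ := ∑ c ∈ range n, openDeg G n col c

/-- The invariant of the greedy algorithm for partial colourings with the colours `0, …, n - 1`,
where the colour `n` marks uncoloured vertices. -/
structure GreedyInv (n : ℕ) (col : V → ℕ) : Prop where
  le : ∀ v, col v ≤ n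
  proper : ∀ x y, G.Adj x y → col x < n → col x ≠ col y
  convex : ∀ x y (p : G.Walk x y), p.IsPath → col x < n → col y < n → ∀ z ∈ p.support, col z < n
  ef : ∀ i < n, ∀ j < n, classDeg G col j ≤ classDeg G col i ∨
    ∃ o, col o = j ∧ classDeg G col j ≤ classDeg G col i + deg G o
  -- Meant for the case that class `i` owns all open edges: the inequality becomes `D_j + u_i ≤ 1 +
  -- D_i` (degree sums `D`, open degrees `u`), so `u_i > 0` forces `D_j ≤ D_i`.
  bal : ∀ i < n, ∃ j < n, j ≠ i ∧ classDeg G col j + 2 * openDeg G n col i ≤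
    1 + classDeg G col i + openTotal G n col
  fill : (∀ c < n, ∃ v, col v = c) ∨ ∀ v w, col v < n → col v = col w → v = w

/-! ### Effect of colouring one vertex on the degree counts. -/

variable {G} {n : ℕ} {col : V → ℕ}

theorem openDeg_le_classDeg (c : ℕ) : openDeg G n col c ≤ classDeg G col c := by
  refine sum_le_sum fun x _ => sum_le_sum fun y _ => ?_
  split_ifs <;> first | omega | (exfalso; tauto)

theorem classDeg_update {v : V} (hv : col v = n) (k : ℕ) {c : ℕ} (hc : c < n) :
    classDeg G (Function.update col v k) c = classDeg G col c + if k = c then deg G v else 0 := by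
  have h : ∀ x, (∑ y, if G.Adj x y ∧ Function.update col v k x = c then 1 else 0) =
      (∑ y, if G.Adj x y ∧ col x = c then 1 else 0) +
        if x = v then (if k = c then deg G v else 0) else 0 := by
    intro x
    by_cases hx : x = v
    · subst hx
      have : col x ≠ c := by omega
      by_cases hk : k = c <;> simp [deg, this, hk]
    · simp [hx]
  simp only [classDeg, h, sum_add_distrib]
  simp

/-- Colouring `v` closes the edges from class `c` to `v` and, if `k = c`, opens those from `v` to
uncoloured neighbours. The closed edges stand on the left to avoid subtraction. -/
theorem openDeg_update {v : V} (hv : col v = n) {k : ℕ} (hk : k < n) {c : ℕ} (hc : c < n) :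
    openDeg G n (Function.update col v k) c + (∑ x, if G.Adj x v ∧ col x = c then 1 else 0) =
      openDeg G n col c +
        if k = c then (∑ y, if G.Adj v y ∧ col y = n then 1 else 0) else 0 := by
  have h : ∀ x y, (if G.Adj x y ∧ Function.update col v k x = c ∧
        Function.update col v k y = n then 1 else 0) +
        (if y = v then (if G.Adj x v ∧ col x = c then 1 else 0) else 0) =
      (if G.Adj x y ∧ col x = c ∧ col y = n then 1 else 0) +
        if x = v then (if k = c then (if G.Adj v y ∧ col y = n then 1 else 0) else 0) else 0 := by
    intro x y
    have hvc : col v ≠ c := by omega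
    have hkn : k ≠ n := by omega
    by_cases hx : x = v <;> by_cases hy : y = v
    · subst hx; subst hy; simp
    · subst hx
      by_cases hk : k = c <;> simp [hy, hvc, hk]
    · subst hy
      simp [hx, hv, hkn]
    · simp [hx, hy]
  have h2 := sum_congr (rfl : (univ : Finset V) = univ)
    fun x _ => sum_congr (rfl : (univ : Finset V) = univ) fun y _ => h x y
  simp only [sum_add_distrib] at h2
  simp only [openDeg]
  convert h2 using 2
  · simp
  · rw [sum_comm]
    split_ifs with hk <;> simp

/-- In a path-convex partial colouring an uncoloured vertex has at most one coloured neighbour. -/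
theorem GreedyInv.eq_of_adj (h : GreedyInv G n col) {v x y : V} (hv : col v = n)
    (hx : G.Adj x v) (hy : G.Adj y v) (hxn : col x < n) (hyn : col y < n) : x = y := by
  by_contra hne
  have hp : (SimpleGraph.Walk.cons hx (SimpleGraph.Walk.cons hy.symm .nil)).IsPath := by
    simp [hx.ne, hy.ne', hne]
  have := h.convex x y _ hp hxn hyn v (by simp)
  omega

theorem openDeg_pos {x v : V} (hxv : G.Adj x v) (hv : col v = n) : 0 < openDeg G n col (col x) := by
  refine sum_pos' (fun _ _ => Nat.zero_le _) ⟨x, mem_univ _, ?_⟩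
  exact sum_pos' (fun _ _ => Nat.zero_le _) ⟨v, mem_univ _, by simp [hxv, hv]⟩

theorem openDeg_add_add_le_openTotal {b c d : ℕ} (hb : b < n) (hc : c < n) (hd : d < n)
    (hbc : b ≠ c) (hbd : b ≠ d) (hcd : c ≠ d) :
    openDeg G n col b + (openDeg G n col c + openDeg G n col d) ≤ openTotal G n col := by
  rw [← sum_pair hcd, ← sum_insert (s := {c, d}) (a := b) (by simp [hbc, hbd])]
  exact sum_le_sum_of_subset (by simp [insert_subset_iff, hb, hc, hd])

/-! ### Extending the coloured part by one vertex. -/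

/-- Giving a vertex to a poorest class keeps all invariants but the balance. -/
theorem GreedyInv.update (h : GreedyInv G n col) {k : ℕ} {v : V} (hk : k < n)
    (hmin : ∀ i < n, classDeg G col k ≤ classDeg G col i) (hv : col v = n)
    (hprop : ∀ w, G.Adj v w → col w ≠ k)
    (hconn : ∀ y (p : G.Walk v y), p.IsPath → col y < n → ∀ z ∈ p.support, z ≠ v → col z < n)
    (hfill : (∃ i < n, ∀ w, col w ≠ i) → ∀ w, col w ≠ k)
    (hbal : ∀ i < n, ∃ j < n, j ≠ i ∧
      classDeg G (Function.update col v k) j + 2 * openDeg G n (Function.update col v k) i ≤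
        1 + classDeg G (Function.update col v k) i + openTotal G n (Function.update col v k)) :
    GreedyInv G n (Function.update col v k) where
  le w := by
    by_cases hw : w = v
    · subst hw; simp; omega
    · rw [Function.update_of_ne hw]; exact h.le w
  proper x y hxy hx := by
    by_cases hxv : x = v
    · subst hxv
      rw [Function.update_self, Function.update_of_ne hxy.ne']
      exact (hprop y hxy).symm
    · rw [Function.update_of_ne hxv] at hx ⊢
      by_cases hyv : y = v
      · subst hyv; rw [Function.update_self]; exact hprop x hxy.symm
      · rw [Function.update_of_ne hyv]; exact h.proper x y hxy hx
  convex x y p hp hx hy z hz := by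
    by_cases hzv : z = v
    · subst hzv; simpa using hk
    rw [Function.update_of_ne hzv]
    by_cases hxv : x = v
    · subst hxv
      by_cases hyv : y = x
      · subst hyv
        rw [SimpleGraph.Walk.isPath_iff_nil, ← SimpleGraph.Walk.eq_nil_iff_nil] at hp
        subst hp
        simp at hz; exact absurd hz hzv
      · rw [Function.update_of_ne hyv] at hy
        exact hconn y p hp hy z hz hzv
    · rw [Function.update_of_ne hxv] at hx
      by_cases hyv : y = v
      · subst hyv
        exact hconn x p.reverse hp.reverse hx z (by simpa using hz) hzv
      · rw [Function.update_of_ne hyv] at hy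
        exact h.convex x y p hp hx hy z hz
  -- For `j = k` the witness is `v`: without it the class is back at its old, minimal degree sum.
  -- Any other class `j` is unchanged, while class `i` has not shrunk.
  ef i hi j hj := by
    rw [classDeg_update hv k hi, classDeg_update hv k hj]
    by_cases hkj : k = j
    · subst hkj
      right
      refine ⟨v, by simp, ?_⟩
      have := hmin i hi
      simp only [if_true]
      omega
    · rw [if_neg hkj]
      rcases h.ef i hi j hj with h1 | ⟨o, ho, h1⟩
      · left; omega
      · right
        refine ⟨o, ?_, by omega⟩
        rw [Function.update_of_ne]
        · exact ho
        · rintro rfl; omega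
  bal := hbal
  fill := by
    by_cases hall : ∀ c < n, ∃ w, col w = c
    · left
      intro c hc
      obtain ⟨w, hw⟩ := hall c hc
      refine ⟨w, ?_⟩
      rw [Function.update_of_ne]
      · exact hw
      · rintro rfl; omega
    · right
      have hinj := h.fill.resolve_left hall
      push Not at hall
      -- Some class was empty, so class `k` was, and `v` is now its only member.
      have hkf := hfill hall
      intro w w' hw hww
      by_cases h1 : w = v <;> by_cases h2 : w' = v
      · rw [h1, h2]
      · subst h1
        rw [Function.update_self, Function.update_of_ne h2] at hww
        exact absurd hww.symm (hkf w')
      · subst h2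
        rw [Function.update_self, Function.update_of_ne h1] at hww
        exact absurd hww (hkf w)
      · rw [Function.update_of_ne h1] at hw
        rw [Function.update_of_ne h1, Function.update_of_ne h2] at hww
        exact hinj w w' hw hww

/-- `a c` counts the edges from class `c` to `v`: an indicator when `v` has a coloured neighbour,
zero when `v` starts a component. -/
theorem sum_openDeg_update {v : V} (hv : col v = n) {k : ℕ} (hk : k < n) {a : ℕ → ℕ}
    (ha : ∀ c < n, (∑ x, if G.Adj x v ∧ col x = c then 1 else 0) = a c) :
    openTotal G n (Function.update col v k) + ∑ c ∈ range n, a c =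
      openTotal G n col + ∑ y, if G.Adj v y ∧ col y = n then 1 else 0 := by
  have h : ∀ c ∈ range n, openDeg G n (Function.update col v k) c + a c =
      openDeg G n col c +
        if k = c then (∑ y, if G.Adj v y ∧ col y = n then 1 else 0) else 0 := by
    intro c hc
    rw [mem_range] at hc
    rw [← ha c hc, openDeg_update hv hk hc]
  have h2 := sum_congr rfl h
  rw [sum_add_distrib, sum_add_distrib, sum_ite_eq, if_pos (mem_range.2 hk)] at h2
  exact h2

/-- Extending the coloured part at a vertex with a coloured neighbour. -/
theorem GreedyInv.attach (hG : G.IsAcyclic) (h : GreedyInv G n col) {k c : ℕ} {x v : V}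
    (hk : k < n) (hc : c < n) (hck : c ≠ k)
    (hmin : ∀ i < n, classDeg G col k ≤ classDeg G col i) (hv : col v = n) (hxv : G.Adj x v)
    (hx : col x = c)
    (hmax : ∀ i < n, i ≠ k → i ≠ c → openDeg G n col i ≤ openDeg G n col c ∧
      (openDeg G n col i < openDeg G n col c ∨ classDeg G col k < classDeg G col i ∨
        0 < openDeg G n col k))
    (hfill : (∃ i < n, ∀ w, col w ≠ i) → ∀ w, col w ≠ k) :
    GreedyInv G n (Function.update col v k) := by
  have huniq : ∀ y, G.Adj y v → col y < n → y = x := fun y hy hyn =>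
    h.eq_of_adj hv hy hxv hyn (by omega)
  have ha : ∀ d < n, (∑ y, if G.Adj y v ∧ col y = d then 1 else 0) = if d = c then 1 else 0 := by
    intro d hd
    rw [sum_eq_single x]
    · simp [hxv, hx, eq_comm]
    · intro y _ hy
      refine if_neg ?_
      rintro ⟨h1, h2⟩
      exact hy (huniq y h1 (by omega))
    · simp
  have hb : (∑ y, if G.Adj v y ∧ col y = n then 1 else 0) + 1 = deg G v := by
    have : ∀ y, (if G.Adj v y then 1 else 0) =
        (if G.Adj v y ∧ col y = n then 1 else 0) + if y = x then 1 else 0 := by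
      intro y
      by_cases hy : y = x
      · subst hy
        have : col y ≠ n := by omega
        simp [hxv.symm, this]
      · by_cases hyv : G.Adj v y
        · have : col y = n := by
            have h1 := h.le y
            by_contra h2
            exact hy (huniq y hyv.symm (by omega))
          simp [hyv, this, hy]
        · simp [hyv, hy]
    simp only [deg, this, sum_add_distrib]
    simp
  have hU := sum_openDeg_update hv hk ha
  rw [sum_ite_eq', if_pos (mem_range.2 hc)] at hU
  have hu : ∀ d < n, _ := fun d hd => openDeg_update (G := G) hv hk hd
  have hucpos : 0 < openDeg G n col c := hx ▸ openDeg_pos hxv hv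
  refine h.update hk hmin hv ?_ ?_ hfill ?_
  · intro w hw hwk
    have := huniq w hw.symm (by omega)
    subst this; omega
  · intro y p hp hy z hz hzv
    -- In a forest a path from `v` through `x` begins with the edge `vx`, and its remainder joins
    -- coloured vertices. A path avoiding `x`, prolonged by `x`, would make `v` an inner vertex
    -- between coloured ones.
    by_cases hxp : x ∈ p.support
    · rw [← p.take_spec hxp, SimpleGraph.Walk.mem_support_append_iff] at hz
      rcases hz with hz | hz
      · have hpath : (SimpleGraph.Walk.cons hxv.symm .nil).IsPath := by
          simp [hxv.ne']
        have := @Subsingleton.elim _ (hG.subsingleton_path _ _)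
          ⟨_, hp.takeUntil hxp⟩ ⟨_, hpath⟩
        rw [Subtype.mk.injEq] at this
        rw [this] at hz
        simp [hzv] at hz
        rw [hz]; omega
      · exact h.convex x y _ (hp.dropUntil hxp) (by omega) hy z hz
    · have := h.convex x y (.cons hxv p) (by simp [hp, hxp]) (by omega) hy v (by simp)
      omega
  · intro i hi
    have hDi := classDeg_update (G := G) hv k hi
    have hDk := classDeg_update (G := G) hv k hk
    have hui := hu i hi
    rw [ha i hi] at hui
    rw [if_pos rfl] at hDk
    -- The total open degree changes by `deg v - 2`. For `i = k` both sides of the inequality grow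
    -- by `2 * deg v - 2`, so the old `j` serves; for `i ≠ k` the class `k` serves as `j`.
    by_cases hik : i = k
    · subst hik
      obtain ⟨j, hj, hji, hJ⟩ := h.bal i hi
      refine ⟨j, hj, hji, ?_⟩
      have hDj := classDeg_update (G := G) hv i hj
      rw [if_neg (Ne.symm hji)] at hDj
      rw [if_neg (Ne.symm hck), if_pos rfl] at hui
      omega
    · refine ⟨k, hk, Ne.symm hik, ?_⟩
      rw [if_neg (Ne.symm hik)] at hDi hui
      by_cases hic : i = c
      · subst hic
        obtain ⟨j, hj, hji, hJ⟩ := h.bal i hi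
        have := hmin j hj
        rw [if_pos rfl] at hui
        omega
      -- Needed is `D_k + 2 * u_i + 1 ≤ D_i + U`. Since `u_i + u_c + u_k ≤ U`, `u_i ≤ u_c` and `D_k
      -- ≤ D_i`, one strict inequality from `hmax` suffices.
      · rw [if_neg hic] at hui
        obtain ⟨h1, h2⟩ := hmax i hi hik hic
        have h3 := openDeg_add_add_le_openTotal (G := G) (col := col) hi hc hk hic hik hck
        have := hmin i hi
        omega

/-- Starting a new component of the coloured part. -/
theorem GreedyInv.root (h : GreedyInv G n col) {k : ℕ} {v : V} (hk : k < n)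
    (hmin : ∀ i < n, classDeg G col k ≤ classDeg G col i) (hv : col v = n)
    (hzero : ∀ i < n, openDeg G n col i = 0)
    (hfill : (∃ i < n, ∀ w, col w ≠ i) → ∀ w, col w ≠ k) :
    GreedyInv G n (Function.update col v k) := by
  have hadj : ∀ x y, G.Adj x y → col x = n → col y = n := by
    intro x y hxy hx
    have h1 := h.le y
    by_contra h2
    have := openDeg_pos hxy.symm hx
    rw [hzero _ (by omega)] at this
    omega
  have hwalk : ∀ x y, G.Walk x y → col x = n → col y = n := by
    intro x y p
    induction p with
    | nil => exact id
    | cons hxy _ ih => exact fun hx => ih (hadj _ _ hxy hx)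
  have ha : ∀ d < n, (∑ y, if G.Adj y v ∧ col y = d then 1 else 0) = 0 := by
    intro d hd
    refine sum_eq_zero fun y _ => if_neg ?_
    rintro ⟨h1, h2⟩
    have := hadj v y h1.symm hv
    omega
  have hb : (∑ y, if G.Adj v y ∧ col y = n then 1 else 0) = deg G v := by
    refine sum_congr rfl fun y _ => ?_
    have := hadj v y
    by_cases hy : G.Adj v y
    · simp [hy, this hy hv]
    · simp [hy]
  have hU := sum_openDeg_update (a := fun _ => 0) hv hk ha
  have hU0 : openTotal G n col = 0 := sum_eq_zero fun c hc => hzero c (mem_range.1 hc)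
  simp only [sum_const_zero] at hU
  refine h.update hk hmin hv ?_ ?_ hfill ?_
  · intro w hw hwk
    have := hadj v w hw hv
    omega
  · intro y p _ hy
    have := hwalk v y p hv
    omega
  · intro i hi
    have hDi := classDeg_update (G := G) hv k hi
    have hDk := classDeg_update (G := G) hv k hk
    have hui := openDeg_update (G := G) hv hk hi
    rw [ha i hi, hzero i hi] at hui
    rw [if_pos rfl] at hDk
    by_cases hik : i = k
    · subst hik
      obtain ⟨j, hj, hji, hJ⟩ := h.bal i hi
      refine ⟨j, hj, hji, ?_⟩
      have hDj := classDeg_update (G := G) hv i hj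
      rw [if_neg (Ne.symm hji)] at hDj
      rw [if_pos rfl] at hui
      omega
    · refine ⟨k, hk, Ne.symm hik, ?_⟩
      rw [if_neg (Ne.symm hik)] at hDi hui
      have := hmin i hi
      omega

theorem GreedyInv.start (hn : 2 ≤ n) (hcol : ∀ v, col v = n) : GreedyInv G n col := by
  have hD : ∀ c < n, classDeg G col c = 0 := by
    intro c hc
    refine sum_eq_zero fun x _ => sum_eq_zero fun y _ => if_neg ?_
    rintro ⟨_, h⟩
    rw [hcol] at h; omega
  have hu : ∀ c < n, openDeg G n col c = 0 := fun c hc =>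
    Nat.le_zero.1 ((openDeg_le_classDeg c).trans (hD c hc).le)
  refine ⟨fun v => (hcol v).le, ?_, ?_, ?_, ?_, ?_⟩
  · intro x y _ hx; rw [hcol] at hx; omega
  · intro x y _ _ hx; rw [hcol] at hx; omega
  · intro i _ j hj; left; rw [hD j hj]; omega
  · intro i hi
    refine ⟨if i = 0 then 1 else 0, by split_ifs <;> omega, by split_ifs <;> omega, ?_⟩
    rw [hD _ (by split_ifs <;> omega), hu i hi]; omega
  · right; intro v w hv; rw [hcol] at hv; omega

end Coloring

/-! ### The greedy choice of class and vertex, and its termination. -/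

section Coloring

variable {V : Type*} [Fintype V] [DecidableEq V] {G : SimpleGraph V} [DecidableRel G.Adj]
  {n : ℕ} {col : V → ℕ}

/-- The indicator of the empty colour classes. -/
def emptyInd (col : V → ℕ) (c : ℕ) : ℕ := if ∃ v, col v = c then 0 else 1

/-- An empty class has degree sum 0, hence so has `k`, which then has no open edges; the tie-break
thus compares emptiness alone. -/
theorem GreedyInv.fill_of_min {k : ℕ}
    (hmin : ∀ i < n, classDeg G col k < classDeg G col i ∨ classDeg G col k = classDeg G col i ∧
      openDeg G n col i + emptyInd col i ≤ openDeg G n col k + emptyInd col k) :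
    (∃ i < n, ∀ w, col w ≠ i) → ∀ w, col w ≠ k := by
  rintro ⟨i, hi, hw⟩ w hwk
  have h1 : classDeg G col i = 0 :=
    sum_eq_zero fun x _ => sum_eq_zero fun y _ => if_neg fun h => hw x h.2
  have h2 : emptyInd col i = 1 := if_neg fun ⟨w, h⟩ => hw w h
  have h3 : emptyInd col k = 0 := if_pos ⟨w, hwk⟩
  have h4 := openDeg_le_classDeg (G := G) (n := n) (col := col) k
  have := hmin i hi
  omega

theorem GreedyInv.step_attach (hG : G.IsAcyclic) (h : GreedyInv G n col) {k c : ℕ} {x v : V}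
    (hk : k < n) (hc : c < n) (hck : c ≠ k)
    (hmin : ∀ i < n, classDeg G col k < classDeg G col i ∨ classDeg G col k = classDeg G col i ∧
      openDeg G n col i + emptyInd col i ≤ openDeg G n col k + emptyInd col k)
    (hmax : ∀ i < n, i ≠ k → openDeg G n col i ≤ openDeg G n col c)
    (hv : col v = n) (hxv : G.Adj x v) (hx : col x = c) :
    GreedyInv G n (Function.update col v k) := by
  have hpos : 0 < openDeg G n col c := hx ▸ openDeg_pos hxv hv
  refine h.attach hG hk hc hck (fun i hi => ?_) hv hxv hx (fun i hi hik hic => ?_)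
    (GreedyInv.fill_of_min hmin)
  · have := hmin i hi; omega
  · have h1 := hmin i hi
    have h2 := hmax i hi hik
    refine ⟨h2, ?_⟩
    -- Otherwise `i` ties with `k`, has open edges, and `k` has none. The tie-break excludes this if
    -- class `k` is non-empty; if it is empty, `D_i = D_k = 0` leaves `i` no open edges.
    by_contra hcon
    have h3 := openDeg_le_classDeg (G := G) (n := n) (col := col) i
    by_cases hke : ∃ w, col w = k
    · have : emptyInd col k = 0 := if_pos hke
      omega
    · have : classDeg G col k = 0 :=
        sum_eq_zero fun x _ => sum_eq_zero fun y _ => if_neg fun h => hke ⟨x, h.2⟩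
      omega

theorem GreedyInv.step_swap (hG : G.IsAcyclic) (h : GreedyInv G n col) {k l : ℕ} {x v : V}
    (hk : k < n) (hl : l < n) (hlk : l ≠ k)
    (hmin : ∀ i < n, classDeg G col k ≤ classDeg G col i)
    (hzero : ∀ i < n, i ≠ k → openDeg G n col i = 0)
    (hlmin : ∀ i < n, i ≠ k → classDeg G col l ≤ classDeg G col i)
    (hv : col v = n) (hxv : G.Adj x v) (hx : col x = k) :
    GreedyInv G n (Function.update col v l) := by
  have hpos : 0 < openDeg G n col k := hx ▸ openDeg_pos hxv hv
  have hU : openTotal G n col = openDeg G n col k :=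
    sum_eq_single_of_mem k (mem_range.2 hk) fun i hi hik => hzero i (mem_range.1 hi) hik
  -- As `U = u_k > 0`, balance gives `D_j ≤ D_k`, so `l` is a poorest class too.
  obtain ⟨j, hj, hjk, hJ⟩ := h.bal k hk
  have h1 := hmin j hj
  have h2 := hlmin j hj hjk
  have h3 := openDeg_le_classDeg (G := G) (n := n) (col := col) k
  refine h.attach hG hl hk hlk.symm (fun i hi => ?_) hv hxv hx (fun i hi hil hik => ?_) ?_
  · have := hmin i hi; omega
  · have := hzero i hi hik; omega
  -- No class is empty: the poorest one, `k`, has an open edge and hence positive degree sum.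
  · rintro ⟨i, hi, hw⟩
    have h4 : classDeg G col i = 0 :=
      sum_eq_zero fun x _ => sum_eq_zero fun y _ => if_neg fun h => hw x h.2
    have := hmin i hi; omega

theorem exists_adj_of_openDeg_pos {c : ℕ} (h : 0 < openDeg G n col c) :
    ∃ x v, G.Adj x v ∧ col x = c ∧ col v = n := by
  by_contra hcon
  push Not at hcon
  refine h.ne' (sum_eq_zero fun x _ => sum_eq_zero fun y _ => if_neg ?_)
  rintro ⟨h1, h2, h3⟩
  exact hcon x y h1 h2 h3

theorem GreedyInv.exists_step (hG : G.IsAcyclic) (hn : 2 ≤ n) (h : GreedyInv G n col) {v : V}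
    (hv : col v = n) : ∃ w, ∃ k < n, col w = n ∧ GreedyInv G n (Function.update col w k) := by
  obtain ⟨k, hk, hmin⟩ := exists_min_image (range n)
    -- Minimal degree sum first, then, through the order dual, maximal open degree plus emptiness.
    (fun i => toLex (classDeg G col i, OrderDual.toDual (openDeg G n col i + emptyInd col i)))
    ⟨0, mem_range.2 (by omega)⟩
  rw [mem_range] at hk
  have hmin' : ∀ i < n, classDeg G col k < classDeg G col i ∨
      classDeg G col k = classDeg G col i ∧
      openDeg G n col i + emptyInd col i ≤ openDeg G n col k + emptyInd col k := by
    intro i hi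
    exact Prod.Lex.le_iff.1 (hmin i (mem_range.2 hi))
  have hne : ((range n).erase k).Nonempty :=
    ⟨if k = 0 then 1 else 0, by simp; split_ifs <;> omega⟩
  obtain ⟨c, hc, hmax⟩ := exists_max_image _ (openDeg G n col) hne
  simp only [mem_erase, mem_range] at hc hmax
  by_cases hpos : 0 < openDeg G n col c
  · obtain ⟨x, w, hxw, hx, hw⟩ := exists_adj_of_openDeg_pos hpos
    exact ⟨w, k, hk, hw, h.step_attach hG hk hc.2 hc.1 hmin'
      (fun i hi hik => hmax i ⟨hik, hi⟩) hw hxw hx⟩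
  have hzero : ∀ i < n, i ≠ k → openDeg G n col i = 0 := fun i hi hik => by
    have := hmax i ⟨hik, hi⟩; omega
  have hmin'' : ∀ i < n, classDeg G col k ≤ classDeg G col i := fun i hi => by
    have := hmin' i hi; omega
  by_cases hpos : 0 < openDeg G n col k
  · obtain ⟨l, hl, hlmin⟩ := exists_min_image _ (classDeg G col) hne
    simp only [mem_erase, mem_range] at hl hlmin
    obtain ⟨x, w, hxw, hx, hw⟩ := exists_adj_of_openDeg_pos hpos
    exact ⟨w, l, hl.2, hw, h.step_swap hG hk hl.2 hl.1 hmin'' hzero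
      (fun i hi hik => hlmin i ⟨hik, hi⟩) hw hxw hx⟩
  · refine ⟨v, k, hk, hv, h.root hk hmin'' hv (fun i hi => ?_) (GreedyInv.fill_of_min hmin')⟩
    by_cases hik : i = k
    · subst hik; omega
    · exact hzero i hi hik

theorem card_uncolored_update {v : V} (hv : col v = n) {k : ℕ} (hk : k < n) :
    #{w | Function.update col v k w = n} + 1 = #{w | col w = n} := by
  rw [← card_erase_add_one (s := {w | col w = n}) (a := v) (by simpa using hv)]
  congr 2
  ext w
  by_cases hw : w = v
  · subst hw; simp; omega
  · simp [hw]

theorem exists_greedyInv_complete (hG : G.IsAcyclic) (hn : 2 ≤ n) :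
    ∃ col : V → ℕ, GreedyInv G n col ∧ ∀ v, col v < n := by
  suffices ∀ (j : ℕ) (col : V → ℕ), GreedyInv G n col → #{w | col w = n} = j →
      ∃ col : V → ℕ, GreedyInv G n col ∧ ∀ v, col v < n from
    this _ (fun _ => n) (GreedyInv.start hn fun _ => rfl) rfl
  intro j
  induction j with
  | zero =>
    intro col h hcard
    refine ⟨col, h, fun v => (h.le v).lt_of_ne fun hv => ?_⟩
    rw [card_eq_zero, filter_eq_empty_iff] at hcard
    exact hcard (mem_univ v) hv
  | succ j ih =>
    intro col h hcard
    obtain ⟨v, hv⟩ : Finset.Nonempty {w | col w = n} := card_pos.1 (by omega)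
    obtain ⟨w, k, hk, hw, h'⟩ := h.exists_step hG hn (by simpa using hv)
    exact ih _ h' (by have := card_uncolored_update hw hk; omega)

/-! ## From colourings to allocations -/

variable (n) in
/-- The allocation given by a colouring. -/
def ofColoring (col : V → ℕ) : Allocation V n where
  bundle i := {v | col v = i}
  disjoint i j hij := by
    rw [disjoint_left]
    intro v hv hv'
    simp only [mem_filter, mem_univ, true_and] at hv hv'
    exact hij (Fin.ext (hv.symm.trans hv'))

theorem cutValue_eq_sum (S : Finset V) :
    cutValue G S = ∑ x, ∑ y, if G.Adj x y ∧ x ∈ S ∧ y ∉ S then 1 else 0 := by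
  rw [cutValue, SimpleGraph.interedges, Rel.interedges, ← sum_product', ← card_filter]
  congr 1
  ext p
  simp
  tauto

/-- An ordered adjacent pair `(x, y)` is counted only by the bundle containing `x`. -/
theorem welfare_le (B : Allocation V n) : B.welfare G ≤ ∑ x, deg G x := by
  simp only [Allocation.welfare, cutValue_eq_sum, deg]
  rw [sum_comm]
  refine sum_le_sum fun x _ => ?_
  rw [sum_comm]
  refine sum_le_sum fun y _ => ?_
  rw [← card_filter]
  split_ifs with h
  · refine card_le_one.2 fun i hi j hj => ?_
    simp only [mem_filter] at hi hj
    by_contra hij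
    exact disjoint_left.1 (B.disjoint i j hij) hi.2.2.1 hj.2.2.1
  · simp [h]

theorem ofColoring_isComplete (hcol : ∀ v, col v < n) : (ofColoring n col).IsComplete :=
  fun v => ⟨⟨col v, hcol v⟩, by simp [ofColoring]⟩

theorem cutValue_ofColoring (hprop : ∀ x y, G.Adj x y → col x ≠ col y) (i : Fin n) :
    cutValue G ((ofColoring n col).bundle i) = classDeg G col i := by
  rw [cutValue_eq_sum, classDeg]
  refine sum_congr rfl fun x _ => sum_congr rfl fun y _ => if_congr ?_ rfl rfl
  simp only [ofColoring, mem_filter, mem_univ, true_and]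
  constructor
  · exact fun h => ⟨h.1, h.2.1⟩
  · exact fun h => ⟨h.1, h.2, fun hy => hprop x y h.1 (h.2.trans hy.symm)⟩

theorem ofColoring_isSociallyOptimal (hcol : ∀ v, col v < n)
    (hprop : ∀ x y, G.Adj x y → col x ≠ col y) : (ofColoring n col).IsSociallyOptimal G := by
  refine ⟨ofColoring_isComplete hcol, fun B _ => (welfare_le B).trans (le_of_eq (Eq.symm ?_))⟩
  simp only [Allocation.welfare, cutValue_ofColoring hprop, classDeg, deg]
  rw [sum_comm]
  refine sum_congr rfl fun x _ => ?_
  rw [sum_comm]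
  refine sum_congr rfl fun y _ => ?_
  by_cases h : G.Adj x y
  · rw [sum_eq_single ⟨col x, hcol x⟩]
    · simp [h]
    · intro i _ hi
      refine if_neg fun h => hi (Fin.ext h.2.symm)
    · simp
  · simp [h]

/-- As `S` is independent, the edges at `o` all leave `S`, and so do the edges that leave `S \ {o}`,
none of which is at `o`. -/
theorem cutValue_sdiff_singleton_add_le (S : Finset V)
    (hS : ∀ x ∈ S, ∀ y ∈ S, ¬ G.Adj x y) {o : V} (ho : o ∈ S) :
    cutValue G (S \ {o}) + deg G o ≤ cutValue G S := by
  have : deg G o = ∑ x, ∑ y, if x = o ∧ G.Adj x y then 1 else 0 := by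
    rw [sum_eq_single o]
    · simp [deg]
    · intro x _ hx; simp [hx]
    · simp
  rw [this, cutValue_eq_sum, cutValue_eq_sum, ← sum_add_distrib]
  refine sum_le_sum fun x _ => ?_
  rw [← sum_add_distrib]
  refine sum_le_sum fun y _ => ?_
  simp only [mem_sdiff, mem_singleton]
  by_cases hxo : x = o
  · subst hxo
    by_cases hy : G.Adj x y
    · have : y ∉ S := fun hyS => hS x ho y hyS hy
      simp [hy, ho, this]
    · simp [hy]
  · by_cases hxS : x ∈ S <;> by_cases hy : G.Adj x y
    · have : y ∉ S := fun hyS => hS x hxS y hyS hy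
      simp [hxo, hxS, this, hy]
    all_goals simp [hxo, hxS, hy]

theorem GreedyInv.ofColoring_spec (h : GreedyInv G n col) (hcol : ∀ v, col v < n) :
    (ofColoring n col).IsComplete ∧ (ofColoring n col).IsEF1 G ∧
      (ofColoring n col).IsSociallyOptimal G ∧
        (n ≤ Fintype.card V → (ofColoring n col).IsNonempty) := by
  have hprop : ∀ x y, G.Adj x y → col x ≠ col y := fun x y hxy => h.proper x y hxy (hcol x)
  refine ⟨ofColoring_isComplete hcol, fun i j hij => ?_, ofColoring_isSociallyOptimal hcol hprop,
    fun hcard i => ?_⟩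
  · rw [cutValue_ofColoring hprop, cutValue_ofColoring hprop] at hij
    obtain ⟨o, ho, hle⟩ := (h.ef i i.2 j j.2).resolve_left (by omega)
    have ho' : o ∈ (ofColoring n col).bundle j := by simpa [ofColoring] using ho
    refine ⟨o, ho', ?_⟩
    have := cutValue_sdiff_singleton_add_le (G := G) ((ofColoring n col).bundle j)
      (fun x hx y hy hxy => by
        simp only [ofColoring, mem_filter, mem_univ, true_and] at hx hy
        exact hprop x y hxy (hx.trans hy.symm)) ho'
    rw [cutValue_ofColoring hprop] at this ⊢
    omega
  · have hall : ∀ c < n, ∃ v, col v = c := by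
      refine h.fill.elim id fun hinj => ?_
      let f : V → Fin n := fun v => ⟨col v, hcol v⟩
      have hf : Function.Injective f := fun v w hvw => hinj v w (hcol v) (by simpa [f] using hvw)
      -- An injective colouring of at least `n` vertices with `n` colours uses all of them.
      have hb := (Fintype.bijective_iff_injective_and_card f).2 ⟨hf, by
        have := Fintype.card_le_of_injective f hf
        rw [Fintype.card_fin] at *
        omega⟩
      intro c hc
      obtain ⟨v, hv⟩ := hb.2 ⟨c, hc⟩
      exact ⟨v, by simpa [f] using hv⟩
    obtain ⟨v, hv⟩ := hall i i.2
    exact ⟨v, by simpa [ofColoring] using hv⟩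

/-- One agent is a separate case because `bal` asks for a second class; here only one complete
allocation exists. -/
theorem ofColoring_one_spec (hcol : ∀ v, col v = 0) :
    (ofColoring 1 col).IsComplete ∧ (ofColoring 1 col).IsEF1 G ∧
      (ofColoring 1 col).IsSociallyOptimal G ∧
        (1 ≤ Fintype.card V → (ofColoring 1 col).IsNonempty) := by
  have hc : (ofColoring 1 col).IsComplete := ofColoring_isComplete fun v => by rw [hcol]; omega
  refine ⟨hc, fun i j hij => ?_, ⟨hc, fun B hB => le_of_eq ?_⟩, fun hcard i => ?_⟩
  · rw [Subsingleton.elim i j] at hij; omega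
  · have h : ∀ A : Allocation V 1, A.IsComplete → ∀ i, A.bundle i = univ := by
      intro A hA i
      refine eq_univ_of_forall fun v => ?_
      obtain ⟨j, hj⟩ := hA v
      rwa [Subsingleton.elim i j]
    simp only [Allocation.welfare, h B hB, h _ hc]
  · obtain ⟨v⟩ := Fintype.card_pos_iff.1 hcard
    exact ⟨v, by simp [ofColoring, hcol, Subsingleton.elim i 0]⟩

theorem exists_fair_optimal (hG : G.IsAcyclic) (hn : 1 ≤ n) :
    ∃ A : Allocation V n, A.IsComplete ∧ A.IsEF1 G ∧ A.IsSociallyOptimal G ∧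
      (n ≤ Fintype.card V → A.IsNonempty) := by
  rcases hn.eq_or_lt with rfl | hn
  · exact ⟨_, ofColoring_one_spec (col := fun _ => 0) fun _ => rfl⟩
  · obtain ⟨col, h, hcol⟩ := exists_greedyInv_complete hG hn
    exact ⟨_, h.ofColoring_spec hcol⟩

/-- Bundles have at most one vertex, so removing it leaves value 0. -/
theorem ofColoring_injective_spec (hcol : ∀ v, col v < n) (hinj : Function.Injective col)
    (hn : Fintype.card V ≤ n) :
    (ofColoring n col).IsComplete ∧ (ofColoring n col).IsEF1 G ∧
      (ofColoring n col).IsSociallyOptimal G ∧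
        (n ≤ Fintype.card V → (ofColoring n col).IsNonempty) := by
  have hprop : ∀ x y, G.Adj x y → col x ≠ col y := fun x y hxy hc => hxy.ne (hinj hc)
  refine ⟨ofColoring_isComplete hcol, fun i j hij => ?_, ofColoring_isSociallyOptimal hcol hprop,
    fun hcard i => ?_⟩
  · obtain ⟨o, ho⟩ : ((ofColoring n col).bundle j).Nonempty := by
      by_contra hne
      rw [not_nonempty_iff_eq_empty] at hne
      simp [hne, cutValue_eq_sum] at hij
    refine ⟨o, ho, le_of_eq_of_le ?_ (Nat.zero_le _)⟩
    have : (ofColoring n col).bundle j \ {o} = ∅ := by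
      ext w
      simp only [ofColoring, mem_filter, mem_univ, true_and, mem_sdiff, mem_singleton,
        notMem_empty, iff_false, not_and_not_right] at ho ⊢
      exact fun hw => hinj (hw.trans ho.symm)
    simp [this, cutValue_eq_sum]
  · let f : V → Fin n := fun v => ⟨col v, hcol v⟩
    have hf : Function.Injective f := fun v w hvw => hinj (by simpa [f] using hvw)
    have hb := (Fintype.bijective_iff_injective_and_card f).2 ⟨hf, by
      rw [Fintype.card_fin]; omega⟩
    obtain ⟨v, hv⟩ := hb.2 i
    exact ⟨v, by simp [ofColoring, ← hv, f]⟩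

end Coloring

end CutDivision

/-! ## A structured language with bounded loops -/

namespace RAM

/-- The memory after `x := a`. -/
def Mem.setVar (s : Mem) (x a : ℕ) : Mem := { s with var := Function.update s.var x a }

/-- The memory after `a[i] := b`. -/
def Mem.setArr (s : Mem) (a i b : ℕ) : Mem :=
  { s with arr := Function.update s.arr a (Function.update (s.arr a) i b) }

@[simp] theorem Mem.setVar_var (s : Mem) (x a y : ℕ) :
    (s.setVar x a).var y = if y = x then a else s.var y := Function.update_apply ..

@[simp] theorem Mem.setVar_arr (s : Mem) (x a : ℕ) : (s.setVar x a).arr = s.arr := rfl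

@[simp] theorem Mem.setArr_var (s : Mem) (a i b : ℕ) : (s.setArr a i b).var = s.var := rfl

@[simp] theorem Mem.setArr_arr (s : Mem) (a i b a' i' : ℕ) :
    (s.setArr a i b).arr a' i' = if a' = a ∧ i' = i then b else s.arr a' i' := by
  by_cases h : a' = a
  · subst h; simp [Mem.setArr, Function.update_apply]
  · simp [Mem.setArr, h]

/-- `f (j - 1) (⋯ (f 1 (f 0 s)))`. -/
def iter (f : ℕ → Mem → Mem) : ℕ → Mem → Mem
  | 0, s => s
  | j + 1, s => f j (iter f j s)

/-- Programs in which all loops are of the form `for x := 0 to y - 1`. -/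
inductive Stmt where
  /-- do nothing -/
  | skip
  /-- `x := e` -/
  | assign (x : ℕ) (e : Expr)
  /-- `a[i] := e` -/
  | store (a : ℕ) (i e : Expr)
  /-- first `c`, then `d` -/
  | seq (c d : Stmt)
  /-- if `e ≠ 0` then `c` else `d` -/
  | branch (e : Expr) (c d : Stmt)
  /-- for `x` from `0` to `y - 1` do `c` -/
  | loop (x y : ℕ) (c : Stmt)

namespace Stmt

/-- The translation to machine programs. -/
def compile : Stmt → Program
  | skip => .skip
  | assign x e => .assign x e
  | store a i e => .store a i e
  | seq c d => .seq c.compile d.compile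
  | branch e c d => .branch e c.compile d.compile
  | loop x y c => .seq (.assign x (.lit 0))
      (.loop (.sub (.var y) (.var x)) (.seq c.compile (.assign x (.add (.var x) (.lit 1)))))

/-- The effect on the memory. -/
def exec : Stmt → Mem → Mem
  | skip, s => s
  | assign x e, s => s.setVar x (e.eval s)
  | store a i e, s => s.setArr a (i.eval s) (e.eval s)
  | seq c d, s => d.exec (c.exec s)
  | branch e c d, s => if e.eval s = 0 then d.exec s else c.exec s
  -- The last assignment mirrors the compiled `while` loop, whose counter stops at the bound.
  | loop x y c, s => (iter (fun j s => c.exec (s.setVar x j)) (s.var y) s).setVar x (s.var y)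

/-- The registers to which a program writes. -/
def writes : Stmt → List ℕ
  | skip => []
  | assign x _ => [x]
  | store _ _ _ => []
  | seq c d => c.writes ++ d.writes
  | branch _ c d => c.writes ++ d.writes
  | loop x _ c => x :: c.writes

/-- The arrays to which a program writes. -/
def stores : Stmt → List ℕ
  | skip => []
  | assign _ _ => []
  | store a _ _ => [a]
  | seq c d => c.stores ++ d.stores
  | branch _ c d => c.stores ++ d.stores
  | loop _ _ c => c.stores

/-- All loops are bounded by registers in `bs`, which are never written to, and no loop variable
is written to in the body of its loop. -/
def ok (bs : List ℕ) : Stmt → Bool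
  | skip => true
  | assign x _ => x ∉ bs
  | store _ _ _ => true
  | seq c d => c.ok bs && d.ok bs
  | branch _ c d => c.ok bs && d.ok bs
  | loop x y c => x ∉ bs && y ∈ bs && x ∉ c.writes && c.ok bs

open Polynomial in
/-- A bound on the running time in terms of a bound on the registers that bound the loops. -/
noncomputable def time : Stmt → Polynomial ℕ
  | skip => 1
  | assign _ e => C (e.cost + 1)
  | store _ i e => C (i.cost + e.cost + 1)
  | seq c d => c.time + d.time
  | branch e c d => C (e.cost + 1) + c.time + d.time
  -- Initialising the counter costs 2 and the failing test 4; each round adds 4 for its test and 4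
  -- for the increment.
  | loop _ _ c => 6 + X * (c.time + 8)

/-! ### Frame rules, the loop rule and the running time. -/

theorem exec_var {c : Stmt} {x : ℕ} (hx : x ∉ c.writes) (s : Mem) :
    (c.exec s).var x = s.var x := by
  induction c generalizing s with
  | skip => rfl
  | assign y e =>
    simp only [writes, List.mem_singleton] at hx
    simp [exec, hx]
  | store a i e => rfl
  | seq c d ihc ihd =>
    simp only [writes, List.mem_append, not_or] at hx
    rw [exec, ihd hx.2, ihc hx.1]
  | branch e c d ihc ihd =>
    simp only [writes, List.mem_append, not_or] at hx
    rw [exec]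
    split_ifs
    · exact ihd hx.2 s
    · exact ihc hx.1 s
  | loop z y c ih =>
    simp only [writes, List.mem_cons, not_or] at hx
    have : ∀ j, (iter (fun j s => c.exec (s.setVar z j)) j s).var x = s.var x := by
      intro j
      induction j with
      | zero => rfl
      | succ j ihj => rw [iter, ih hx.2, Mem.setVar_var, if_neg hx.1, ihj]
    rw [exec, Mem.setVar_var, if_neg hx.1, this]

theorem exec_arr {c : Stmt} {a : ℕ} (ha : a ∉ c.stores) (s : Mem) :
    (c.exec s).arr a = s.arr a := by
  induction c generalizing s with
  | skip => rfl
  | assign y e => rfl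
  | store b i e =>
    simp only [stores, List.mem_singleton] at ha
    simp [exec, Mem.setArr, ha]
  | seq c d ihc ihd =>
    simp only [stores, List.mem_append, not_or] at ha
    rw [exec, ihd ha.2, ihc ha.1]
  | branch e c d ihc ihd =>
    simp only [stores, List.mem_append, not_or] at ha
    rw [exec]
    split_ifs
    · exact ihd ha.2 s
    · exact ihc ha.1 s
  | loop z y c ih =>
    have : ∀ j, (iter (fun j s => c.exec (s.setVar z j)) j s).arr a = s.arr a := by
      intro j
      induction j with
      | zero => rfl
      | succ j ihj => rw [iter, ih ha, Mem.setVar_arr, ihj]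
    rw [exec, Mem.setVar_arr, this]

/-- The rule for loop invariants: `P j` holds after `j` rounds, and `hf` covers the final assignment
to the loop variable. -/
theorem exec_loop_induction {x y N : ℕ} {c : Stmt} {s : Mem} (hN : s.var y = N)
    (P : ℕ → Mem → Prop) (h0 : P 0 s)
    (hs : ∀ j s, j < N → P j s → P (j + 1) (c.exec (s.setVar x j)))
    (hf : ∀ s, P N s → P N (s.setVar x N)) : P N ((loop x y c).exec s) := by
  rw [exec, hN]
  refine hf _ ?_
  suffices ∀ j ≤ N, P j (iter (fun j s => c.exec (s.setVar x j)) j s) from this N le_rfl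
  intro j
  induction j with
  | zero => exact fun _ => h0
  | succ j ih => exact fun hj => hs j _ hj (ih (by omega))

theorem not_mem_writes_of_ok {bs : List ℕ} {c : Stmt} (h : c.ok bs) {y : ℕ} (hy : y ∈ bs) :
    y ∉ c.writes := by
  induction c with
  | skip => simp [writes]
  | assign x e =>
    simp only [ok, decide_eq_true_eq] at h
    simp only [writes, List.mem_singleton]
    rintro rfl; exact h hy
  | store a i e => simp [writes]
  | seq c d ihc ihd =>
    simp only [ok, Bool.and_eq_true] at h
    simp [writes, ihc h.1, ihd h.2]
  | branch e c d ihc ihd =>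
    simp only [ok, Bool.and_eq_true] at h
    simp [writes, ihc h.1, ihd h.2]
  | loop x z c ih =>
    simp only [ok, Bool.and_eq_true, decide_eq_true_eq] at h
    simp only [writes, List.mem_cons, not_or]
    refine ⟨?_, ih h.2⟩
    rintro rfl; exact h.1.1.1 hy

theorem compile_exec {bs : List ℕ} {c : Stmt} (h : c.ok bs) {M : ℕ} {s : Mem}
    (hs : ∀ y ∈ bs, s.var y ≤ M) : ∃ t ≤ c.time.eval M, Exec c.compile s (c.exec s) t := by
  induction c generalizing s with
  | skip => exact ⟨1, by simp [time], .skip s⟩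
  | assign x e => exact ⟨_, by simp [time], .assign x e s⟩
  | store a i e => exact ⟨_, by simp [time], .store a i e s⟩
  | seq c d ihc ihd =>
    simp only [ok, Bool.and_eq_true] at h
    obtain ⟨t, ht, hc⟩ := ihc h.1 hs
    obtain ⟨t', ht', hd⟩ := ihd (s := c.exec s) h.2 fun y hy => by
      rw [exec_var (not_mem_writes_of_ok h.1 hy)]; exact hs y hy
    exact ⟨t + t', by rw [time, Polynomial.eval_add]; omega, .seq hc hd⟩
  | branch e c d ihc ihd =>
    simp only [ok, Bool.and_eq_true] at h
    rw [exec, compile]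
    simp only [time, Polynomial.eval_add, Polynomial.eval_C]
    split_ifs with he
    · obtain ⟨t, ht, hd⟩ := ihd h.2 hs
      exact ⟨e.cost + 1 + t, by omega, .branch_false he hd⟩
    · obtain ⟨t, ht, hc⟩ := ihc h.1 hs
      exact ⟨e.cost + 1 + t, by omega, .branch_true he hc⟩
  | loop x y c ih =>
    simp only [ok, Bool.and_eq_true, decide_eq_true_eq] at h
    obtain ⟨⟨⟨hx, hy⟩, hxc⟩, hc⟩ := h
    have hyx : y ≠ x := by rintro rfl; exact hx hy
    have hyc := not_mem_writes_of_ok hc hy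
    set f : ℕ → Mem → Mem := fun j s => c.exec (s.setVar x j) with hf
    set N := s.var y with hN
    have hfv : ∀ j, ∀ z ∈ bs, (iter f j s).var z = s.var z := by
      intro j z hz
      induction j with
      | zero => rfl
      | succ j ihj =>
        have hzx : z ≠ x := by rintro rfl; exact hx hz
        rw [iter, hf, exec_var (not_mem_writes_of_ok hc hz), Mem.setVar_var, if_neg hzx, ihj]
    -- Induction on the number `k` of rounds left.
    have key : ∀ k j, j + k = N → ∃ t ≤ 4 + k * (c.time.eval M + 8),
        Exec (.loop (.sub (.var y) (.var x))
          (.seq c.compile (.assign x (.add (.var x) (.lit 1)))))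
          ((iter f j s).setVar x j) ((iter f N s).setVar x N) t := by
      intro k
      induction k with
      | zero =>
        intro j hj
        obtain rfl : j = N := by omega
        refine ⟨_, ?_, .loop_false ?_⟩
        · simp [Expr.cost]
        · simp [Expr.eval, hyx, hfv N y hy, ← hN]
      | succ k ihk =>
        intro j hj
        obtain ⟨t, ht, hrun⟩ := ihk (j + 1) (by omega)
        obtain ⟨t', ht', hbody⟩ := ih (s := (iter f j s).setVar x j) hc fun z hz => by
          have hzx : z ≠ x := by rintro rfl; exact hx hz
          rw [Mem.setVar_var, if_neg hzx, hfv j z hz]; exact hs z hz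
        refine ⟨_, ?_, .loop_true (t' := t) ?_ (.seq hbody (.assign x _ _)) ?_⟩
        · simp only [Expr.cost]
          have : (k + 1) * (c.time.eval M + 8) = k * (c.time.eval M + 8) + c.time.eval M + 8 := by
            ring
          omega
        · simp [Expr.eval, hyx, hfv j y hy, ← hN]; omega
        · convert hrun using 1
          change Mem.setVar _ x _ = _
          simp [Expr.eval, iter, hf, exec_var hxc]
    obtain ⟨t, ht, hrun⟩ := key N 0 (by omega)
    refine ⟨_, ?_, .seq (.assign x (.lit 0) s) hrun⟩
    have h1 : N * (c.time.eval M + 8) ≤ M * (c.time.eval M + 8) :=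
      Nat.mul_le_mul_right _ (hs y hy)
    simp only [time, Expr.cost, Polynomial.eval_add, Polynomial.eval_mul, Polynomial.eval_X,
      Polynomial.eval_ofNat]
    omega

end Stmt

end RAM

namespace CutDivision

open Finset RAM RAM.Stmt

/-! ## The program -/

/-- `L` together with its reversal lists each ordered adjacent pair exactly once. -/
theorem IsEdgeList.sum_eq {m : ℕ} {G : SimpleGraph (Fin m)} [DecidableRel G.Adj]
    {L : List (Fin m × Fin m)} (hL : IsEdgeList G L) (f : Fin m → Fin m → ℕ) :
    (L.map fun e => f e.1 e.2 + f e.2 e.1).sum = ∑ x, ∑ y, if G.Adj x y then f x y else 0 := by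
  have hadj : ∀ e ∈ L, G.Adj e.1 e.2 := fun e he => by
    have := (hL.2 s(e.1, e.2)).1 (List.mem_map_of_mem he)
    simpa using this
  have hnd : (L ++ L.map Prod.swap).Nodup := by
    have h1 : L.Nodup := List.Nodup.of_map _ hL.1
    refine List.nodup_append'.2 ⟨h1, h1.map Prod.swap_injective, ?_⟩
    intro e he he'
    obtain ⟨e', hmem, rfl⟩ := List.mem_map.1 he'
    have := List.inj_on_of_nodup_map hL.1 he hmem Sym2.eq_swap
    have h2 := hadj _ hmem
    have h3 : e'.2 = e'.1 := congrArg Prod.fst this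
    exact h2.ne h3.symm
  have hmem : ∀ e : Fin m × Fin m, e ∈ L ++ L.map Prod.swap ↔ G.Adj e.1 e.2 := by
    intro e
    constructor
    · intro he
      rcases List.mem_append.1 he with he | he
      · exact hadj e he
      · obtain ⟨e', he', rfl⟩ := List.mem_map.1 he
        exact (hadj e' he').symm
    · intro he
      have := (hL.2 s(e.1, e.2)).2 (by simpa using he)
      obtain ⟨e', he', h⟩ := List.mem_map.1 this
      rw [List.mem_append]
      rcases Sym2.eq_iff.1 h with ⟨h1, h2⟩ | ⟨h1, h2⟩
      · left; rwa [← Prod.ext (x := e') (y := e) h1 h2]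
      · right; exact List.mem_map.2 ⟨e', he', Prod.ext h2 h1⟩
  have : (L.map fun e => f e.1 e.2 + f e.2 e.1).sum =
      ((L ++ L.map Prod.swap).map fun e => f e.1 e.2).sum := by
    rw [List.map_append, List.sum_append, List.map_map, ← List.sum_map_add]
    rfl
  rw [this, ← List.sum_toFinset _ hnd, ← Finset.sum_product', ← Finset.sum_filter]
  refine Finset.sum_congr ?_ fun _ _ => rfl
  ext e
  simpa using hmem e

theorem IsEdgeList.length_le {m : ℕ} {G : SimpleGraph (Fin m)}
    {L : List (Fin m × Fin m)} (hL : IsEdgeList G L) : L.length ≤ m * m := by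
  have h1 : L.Nodup := List.Nodup.of_map _ hL.1
  simpa using h1.length_le_card

/-- `s` holds the input `n`, `m`, `L`, and the colouring `A`. -/
structure Ctx (n m : ℕ) (L : List (Fin m × Fin m)) (A : ℕ → ℕ) (s : Mem) : Prop where
  var_zero : s.var 0 = n
  var_one : s.var 1 = m
  var_two : s.var 2 = L.length
  fst : ∀ (j : ℕ) (h : j < L.length), s.arr 0 j = L[j].1
  snd : ∀ (j : ℕ) (h : j < L.length), s.arr 1 j = L[j].2
  col : s.arr 2 = A

variable {n m : ℕ} {L : List (Fin m × Fin m)} {A : ℕ → ℕ} {s : Mem}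

theorem Ctx.setVar (h : Ctx n m L A s) {x : ℕ} (hx : 3 ≤ x) (a : ℕ) : Ctx n m L A (s.setVar x a) := by
  refine ⟨?_, ?_, ?_, h.fst, h.snd, h.col⟩
  · rw [Mem.setVar_var, if_neg (by omega), h.var_zero]
  · rw [Mem.setVar_var, if_neg (by omega), h.var_one]
  · rw [Mem.setVar_var, if_neg (by omega), h.var_two]

theorem Ctx.exec (h : Ctx n m L A s) (c : Stmt) (h0 : 0 ∉ c.writes := by decide)
    (h1 : 1 ∉ c.writes := by decide) (h2 : 2 ∉ c.writes := by decide)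
    (a0 : 0 ∉ c.stores := by decide) (a1 : 1 ∉ c.stores := by decide)
    (a2 : 2 ∉ c.stores := by decide) : Ctx n m L A (c.exec s) := by
  refine ⟨?_, ?_, ?_, ?_, ?_, ?_⟩
  · rw [exec_var h0, h.var_zero]
  · rw [exec_var h1, h.var_one]
  · rw [exec_var h2, h.var_two]
  · rw [exec_arr a0]; exact h.fst
  · rw [exec_arr a1]; exact h.snd
  · rw [exec_arr a2]; exact h.col

/-! ### Initialisation and counting passes. -/

/-- Set the colour of all vertices to `n`. -/
def initCol : Stmt := .loop 4 1 (.store 2 (.var 4) (.var 0))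

/-- Reset the arrays 3, 4, 5. -/
def reset : Stmt :=
  .loop 4 0 (.seq (.store 3 (.var 4) (.lit 0)) (.seq (.store 4 (.var 4) (.lit 0))
    (.store 5 (.var 4) (.lit 1))))

/-- The colour of the first endpoint of the current edge. -/
abbrev colFst : Expr := .get 2 (.get 0 (.var 4))

/-- The colour of the second endpoint of the current edge. -/
abbrev colSnd : Expr := .get 2 (.get 1 (.var 4))

/-- Increment an entry of the array `a`. -/
abbrev incr (a : ℕ) (i : Expr) : Stmt := .store a i (.add (.get a i) (.lit 1))

/-- Count the edges at each class in array 3, and those to uncoloured vertices in array 4. -/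
def count : Stmt :=
  .loop 4 2 (.seq (.seq (incr 3 colFst) (incr 3 colSnd))
    (.seq (.branch (.sub (.var 0) colSnd) .skip (incr 4 colFst))
      (.branch (.sub (.var 0) colFst) .skip (incr 4 colSnd))))

/-- Mark the non-empty classes by `0` in array 5. -/
def flags : Stmt := .loop 4 1 (.store 5 (.get 2 (.var 4)) (.lit 0))

theorem reset_spec (h : Ctx n m L A s) :
    ∀ c < n, (reset.exec s).arr 3 c = 0 ∧ (reset.exec s).arr 4 c = 0 ∧
      (reset.exec s).arr 5 c = 1 := by
  refine exec_loop_induction h.var_zero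
    (fun j s => ∀ c < j, s.arr 3 c = 0 ∧ s.arr 4 c = 0 ∧ s.arr 5 c = 1) ?_ ?_ ?_
  · intro c hc; omega
  · intro j s hj ih c hc
    by_cases hcj : c = j
    · simp [Stmt.exec, Expr.eval, hcj]
    · simpa [Stmt.exec, Expr.eval, hcj] using ih c (by omega)
  · exact fun s h => h

theorem initCol_spec (h : Ctx n m L A s) :
    ∃ A', Ctx n m L A' (initCol.exec s) ∧ ∀ v < m, A' v = n := by
  have : ∃ A', Ctx n m L A' (initCol.exec s) ∧ ∀ v < m, A' v = n := by
    refine exec_loop_induction h.var_one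
      (fun j s => ∃ A', Ctx n m L A' s ∧ ∀ v < j, A' v = n) ⟨A, h, by simp⟩ ?_ ?_
    · rintro j s hj ⟨A', hs, hA'⟩
      refine ⟨Function.update A' j n, ⟨?_, ?_, ?_, ?_, ?_, ?_⟩, ?_⟩
      · simp [Stmt.exec, hs.var_zero]
      · simp [Stmt.exec, hs.var_one]
      · simp [Stmt.exec, hs.var_two]
      · simpa [Stmt.exec] using hs.fst
      · simpa [Stmt.exec] using hs.snd
      · funext v
        simp [Stmt.exec, Expr.eval, Function.update_apply, hs.var_zero, hs.col]
      · intro v hv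
        by_cases hvj : v = j
        · simp [hvj]
        · simpa [hvj] using hA' v (by omega)
    · rintro s ⟨A', hs, hA'⟩
      exact ⟨A', hs.setVar (by omega) _, hA'⟩
  exact this

theorem count_spec (h : Ctx n m L A s) (hA : ∀ v : Fin m, A v ≤ n)
    (h0 : ∀ c < n, s.arr 3 c = 0 ∧ s.arr 4 c = 0) :
    ∀ c < n, (count.exec s).arr 3 c =
        (L.map fun e => (if A e.1 = c then 1 else 0) + if A e.2 = c then 1 else 0).sum ∧
      (count.exec s).arr 4 c =
        (L.map fun e => (if A e.1 = c ∧ A e.2 = n then 1 else 0) +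
          if A e.2 = c ∧ A e.1 = n then 1 else 0).sum := by
  have : Ctx n m L A (count.exec s) ∧ ∀ c < n, (count.exec s).arr 3 c =
        ((L.take L.length).map
          fun e => (if A e.1 = c then 1 else 0) + if A e.2 = c then 1 else 0).sum ∧
      (count.exec s).arr 4 c =
        ((L.take L.length).map fun e => (if A e.1 = c ∧ A e.2 = n then 1 else 0) +
          if A e.2 = c ∧ A e.1 = n then 1 else 0).sum := by
    refine exec_loop_induction h.var_two (fun j s => Ctx n m L A s ∧ ∀ c < n, s.arr 3 c =
        ((L.take j).map
          fun e => (if A e.1 = c then 1 else 0) + if A e.2 = c then 1 else 0).sum ∧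
      s.arr 4 c =
        ((L.take j).map fun e => (if A e.1 = c ∧ A e.2 = n then 1 else 0) +
          if A e.2 = c ∧ A e.1 = n then 1 else 0).sum) ⟨h, by simpa using h0⟩ ?_ ?_
    · rintro j s hj ⟨hs, ih⟩
      refine ⟨(hs.setVar (by omega) _).exec _, fun c hc => ?_⟩
      obtain ⟨ih3, ih4⟩ := ih c hc
      have h1 := hA L[j].1
      have h2 := hA L[j].2
      have e1 : s.arr 2 (s.arr 0 j) = A L[j].1 := by rw [hs.col, hs.fst j hj]
      have e2 : s.arr 2 (s.arr 1 j) = A L[j].2 := by rw [hs.col, hs.snd j hj]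
      rw [List.take_add_one, List.getElem?_eq_getElem hj]
      simp only [Option.toList_some, List.map_append, List.sum_append, List.map_cons,
        List.map_nil, List.sum_singleton, ← ih3, ← ih4]
      generalize A L[j].1 = p at *
      generalize A L[j].2 = q at *
      have hnc : ¬ n - c = 0 := by omega
      -- Colours are at most `n`, so the truncated difference vanishes exactly at uncoloured
      -- vertices.
      by_cases hp : n - p = 0 <;> by_cases hq : n - q = 0 <;>
        by_cases hpc : p = c <;> by_cases hqc : q = c <;>
        have hcp : c = p ↔ p = c := eq_comm <;>
        have hcq : c = q ↔ q = c := eq_comm <;>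
        have hp' : p = n ↔ n - p = 0 := (by omega) <;>
        have hq' : q = n ↔ n - q = 0 := (by omega) <;>
        first
        | omega
        | (simp [Stmt.exec, Expr.eval, hs.var_zero, e1, e2, hp, hq, hp', hq', hpc, hqc, hnc,
            hcp, hcq]
           try omega)
    · rintro s ⟨hs, ih⟩
      exact ⟨hs.setVar (by omega) _, ih⟩
  simpa using this.2

theorem flags_spec (h : Ctx n m L A s) (h0 : ∀ c < n, s.arr 5 c = 1) :
    ∀ c < n, (flags.exec s).arr 5 c = if ∃ v < m, A v = c then 0 else 1 := by
  have : Ctx n m L A (flags.exec s) ∧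
      ∀ c < n, (flags.exec s).arr 5 c = if ∃ v < m, A v = c then 0 else 1 := by
    refine exec_loop_induction h.var_one (fun j s => Ctx n m L A s ∧
      ∀ c < n, s.arr 5 c = if ∃ v < j, A v = c then 0 else 1) ⟨h, by simpa using h0⟩ ?_ ?_
    · rintro j s hj ⟨hs, ih⟩
      refine ⟨(hs.setVar (by omega) _).exec _, fun c hc => ?_⟩
      simp only [Stmt.exec, Expr.eval, Mem.setVar_var, Mem.setVar_arr, Mem.setArr_arr, hs.col,
        ih c hc, Nat.exists_lt_succ_right]
      by_cases hcj : c = A j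
      · simp [hcj]
      · simp [hcj, eq_comm]
    · rintro s ⟨hs, ih⟩
      exact ⟨hs.setVar (by omega) _, ih⟩
  exact this.2

/-! ### Selection of classes and of the next vertex. -/

/-- An expression that vanishes if and only if `e` and `f` are equal. -/
abbrev dist (e f : Expr) : Expr := .add (.sub e f) (.sub f e)

/-- Put into register 5 a class of minimal degree sum, and among those one for which the sum
of the arrays 4 and 5 is maximal. -/
def selPoorest : Stmt :=
  .seq (.assign 5 (.lit 0)) (.loop 4 0
    (.branch (.sub (.get 3 (.var 5)) (.get 3 (.var 4))) (.assign 5 (.var 4))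
      (.branch (.sub (.get 3 (.var 4)) (.get 3 (.var 5))) .skip
        (.branch (.sub (.add (.get 4 (.var 4)) (.get 5 (.var 4)))
            (.add (.get 4 (.var 5)) (.get 5 (.var 5)))) (.assign 5 (.var 4)) .skip))))

/-- Put into register 6 a class, different from the one in register 5, with the most edges to
uncoloured vertices, or `n` if no such class has any. -/
def selOpen : Stmt :=
  .seq (.seq (.store 4 (.var 0) (.lit 0)) (.assign 6 (.var 0)))
    (.loop 4 0 (.branch (dist (.var 4) (.var 5))
      (.branch (.sub (.get 4 (.var 4)) (.get 4 (.var 6))) (.assign 6 (.var 4)) .skip) .skip))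

/-- Put into register 5 a class of minimal degree sum among those different from the one in
register 6. -/
def selOther : Stmt :=
  .seq (.assign 5 (.sub (.lit 1) (.var 6))) (.loop 4 0 (.branch (dist (.var 4) (.var 6))
    (.branch (.sub (.get 3 (.var 5)) (.get 3 (.var 4))) (.assign 5 (.var 4)) .skip) .skip))

/-- If only the class in register 5 has edges to uncoloured vertices, move it to register 6. -/
def swapClasses : Stmt :=
  .branch (.sub (.var 0) (.var 6)) .skip
    (.branch (.get 4 (.var 5)) (.seq (.assign 6 (.var 5)) selOther) .skip)

/-- Put into register 7 an uncoloured vertex. -/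
def selUncolored : Stmt :=
  .loop 4 1 (.branch (.sub (.var 0) (.get 2 (.var 4))) .skip (.assign 7 (.var 4)))

/-- Put into register 7 an uncoloured neighbour of the class in register 6, if there is one. -/
def selNeighbor : Stmt :=
  .loop 4 2 (.seq
    (.branch (.add (dist colFst (.var 6)) (.sub (.var 0) colSnd)) .skip
      (.assign 7 (.get 1 (.var 4))))
    (.branch (.add (dist colSnd (.var 6)) (.sub (.var 0) colFst)) .skip
      (.assign 7 (.get 0 (.var 4)))))

theorem selPoorest_spec (h : Ctx n m L A s) (hn : 0 < n) :
    (selPoorest.exec s).var 5 < n ∧ ∀ i < n,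
      s.arr 3 ((selPoorest.exec s).var 5) < s.arr 3 i ∨
      s.arr 3 ((selPoorest.exec s).var 5) = s.arr 3 i ∧
        s.arr 4 i + s.arr 5 i ≤
          s.arr 4 ((selPoorest.exec s).var 5) + s.arr 5 ((selPoorest.exec s).var 5) := by
  have h' := h.setVar (x := 5) (by omega) 0
  refine (exec_loop_induction h'.var_zero (fun j t => t.arr = s.arr ∧ t.var 5 < n ∧ ∀ i < j,
    s.arr 3 (t.var 5) < s.arr 3 i ∨ s.arr 3 (t.var 5) = s.arr 3 i ∧
      s.arr 4 i + s.arr 5 i ≤ s.arr 4 (t.var 5) + s.arr 5 (t.var 5)) ?_ ?_ ?_).2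
  · exact ⟨rfl, by simpa [Stmt.exec, Expr.eval] using hn, by simp⟩
  · rintro j t hj ⟨harr, h5, ih⟩
    simp only [Stmt.exec, Expr.eval, Mem.setVar_var, Mem.setVar_arr, harr, if_true,
      show (5 : ℕ) ≠ 4 by decide, if_false]
    split_ifs with c1 c2 c3 <;> refine ⟨harr, by simpa using by omega, fun i hi => ?_⟩ <;>
      simp only [Mem.setVar_var, if_true, show (5 : ℕ) ≠ 4 by decide, if_false] <;>
      rcases Nat.lt_succ_iff_lt_or_eq.1 hi with hi | rfl <;> try have := ih i hi
    all_goals omega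
  · rintro t ⟨harr, h5, ih⟩
    simpa using ⟨harr, h5, ih⟩

/-- Index `n`, which is no class, is a sentinel with count 0: only a class with an open edge beats
it. -/
theorem selOpen_spec (h : Ctx n m L A s) :
    (∀ i < n, (selOpen.exec s).arr 4 i = s.arr 4 i) ∧
    (((selOpen.exec s).var 6 = n ∧ ∀ i < n, i ≠ s.var 5 → s.arr 4 i = 0) ∨
      ((selOpen.exec s).var 6 < n ∧ (selOpen.exec s).var 6 ≠ s.var 5 ∧
        0 < s.arr 4 ((selOpen.exec s).var 6) ∧
        ∀ i < n, i ≠ s.var 5 → s.arr 4 i ≤ s.arr 4 ((selOpen.exec s).var 6))) := by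
  have h' : Ctx n m L A ((Stmt.seq (.store 4 (.var 0) (.lit 0)) (.assign 6 (.var 0))).exec s) :=
    h.exec _
  have := exec_loop_induction (x := 4) (c := .branch (dist (.var 4) (.var 5))
      (.branch (.sub (.get 4 (.var 4)) (.get 4 (.var 6))) (.assign 6 (.var 4)) .skip) .skip)
    h'.var_zero (fun j t => (∀ i < n, t.arr 4 i = s.arr 4 i) ∧ t.arr 4 n = 0 ∧
      t.var 5 = s.var 5 ∧
      ((t.var 6 = n ∧ ∀ i < j, i ≠ s.var 5 → s.arr 4 i = 0) ∨
      (t.var 6 < n ∧ t.var 6 ≠ s.var 5 ∧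
        0 < s.arr 4 (t.var 6) ∧
        ∀ i < j, i ≠ s.var 5 → s.arr 4 i ≤ s.arr 4 (t.var 6)))) ?_ ?_ ?_
  · exact ⟨this.1, this.2.2.2⟩
  · refine ⟨fun i hi => ?_, ?_, ?_, Or.inl ⟨?_, by simp⟩⟩ <;>
      simp [Stmt.exec, Expr.eval, h.var_zero]
    omega
  · rintro j t hj ⟨h4, h4n, h5, ih⟩
    have h4j := h4 j hj
    simp only [Stmt.exec, Expr.eval, Mem.setVar_var, Mem.setVar_arr, h4j, h5, if_true,
      show (5 : ℕ) ≠ 4 by decide, show (6 : ℕ) ≠ 4 by decide, if_false]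
    rcases ih with ⟨h6, ih⟩ | ⟨h6, h65, hpos, ih⟩
    · rw [h6, h4n]
      split_ifs with c1 c2
      · refine ⟨h4, h4n, by simpa using h5, Or.inl ⟨by simpa using h6, fun i hi hi5 => ?_⟩⟩
        exact ih i (by omega) hi5
      · refine ⟨h4, h4n, by simpa using h5, Or.inl ⟨by simpa using h6, fun i hi hi5 => ?_⟩⟩
        rcases Nat.lt_succ_iff_lt_or_eq.1 hi with hi | rfl
        · exact ih i hi hi5
        · omega
      · refine ⟨h4, h4n, by simpa using h5, Or.inr ⟨by simpa using hj, ?_, ?_, fun i hi hi5 => ?_⟩⟩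
        · simp; omega
        · simp; omega
        · simp only [Mem.setVar_var, if_true]
          rcases Nat.lt_succ_iff_lt_or_eq.1 hi with hi | rfl
          · rw [ih i hi hi5]; omega
          · exact le_rfl
    · rw [h4 _ h6]
      split_ifs with c1 c2
      · refine ⟨h4, h4n, by simpa using h5, Or.inr ⟨by simpa using h6, by simpa using h65,
          by simpa using hpos, fun i hi hi5 => ?_⟩⟩
        simpa using ih i (by omega) hi5
      · refine ⟨h4, h4n, by simpa using h5, Or.inr ⟨by simpa using h6, by simpa using h65,
          by simpa using hpos, fun i hi hi5 => ?_⟩⟩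
        rcases Nat.lt_succ_iff_lt_or_eq.1 hi with hi | rfl
        · simpa using ih i hi hi5
        · simp; omega
      · refine ⟨h4, h4n, by simpa using h5, Or.inr ⟨by simpa using hj, ?_, ?_, fun i hi hi5 => ?_⟩⟩
        · simp; omega
        · simp; omega
        · simp only [Mem.setVar_var, if_true]
          rcases Nat.lt_succ_iff_lt_or_eq.1 hi with hi | rfl
          · have := ih i hi hi5; omega
          · exact le_rfl
  · rintro t ht
    simpa using ht

/-- The start value `1 - s.var 6`, truncated, is 1 for class 0 and 0 otherwise: a different class,
valid since `2 ≤ n`. -/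
theorem selOther_spec (h : Ctx n m L A s) (hn : 2 ≤ n) :
    (selOther.exec s).var 5 < n ∧ (selOther.exec s).var 5 ≠ s.var 6 ∧
      ∀ i < n, i ≠ s.var 6 → s.arr 3 ((selOther.exec s).var 5) ≤ s.arr 3 i := by
  have h' := h.setVar (x := 5) (by omega) (1 - s.var 6)
  refine (exec_loop_induction h'.var_zero (fun j t => t.arr = s.arr ∧ t.var 6 = s.var 6 ∧
    t.var 5 < n ∧ t.var 5 ≠ s.var 6 ∧ ∀ i < j, i ≠ s.var 6 →
      s.arr 3 (t.var 5) ≤ s.arr 3 i) ?_ ?_ ?_).2.2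
  · refine ⟨rfl, by simp, ?_, ?_, by simp⟩
    · simp; omega
    · simp; omega
  · rintro j t hj ⟨harr, h6, h5, h56, ih⟩
    simp only [Stmt.exec, Expr.eval, Mem.setVar_var, Mem.setVar_arr, harr, if_true, h6,
      show (5 : ℕ) ≠ 4 by decide, show (6 : ℕ) ≠ 4 by decide, if_false]
    split_ifs with c1 c2 <;>
      refine ⟨harr, by simpa using h6, by simpa using by omega, by simpa using by omega,
        fun i hi hi6 => ?_⟩ <;>
      simp only [Mem.setVar_var, if_true, show (5 : ℕ) ≠ 4 by decide, if_false] <;>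
      rcases Nat.lt_succ_iff_lt_or_eq.1 hi with hi | rfl <;> try have := ih i hi hi6
    all_goals omega
  · rintro t ht
    simpa using ht

theorem selUncolored_spec (h : Ctx n m L A s) (hA : ∀ v : Fin m, A v ≤ n)
    (hex : ∃ v : Fin m, A v = n) :
    ∃ w : Fin m, (selUncolored.exec s).var 7 = w ∧ A w = n := by
  obtain ⟨v, hv⟩ := hex
  refine (exec_loop_induction h.var_one (fun j t => Ctx n m L A t ∧ ((∃ v < j, A v = n) →
    ∃ w : Fin m, t.var 7 = w ∧ A w = n)) ?_ ?_ ?_).2 ⟨v, v.2, hv⟩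
  · exact ⟨h, by rintro ⟨v, hv, _⟩; omega⟩
  · rintro j t hj ⟨ht, ih⟩
    refine ⟨(ht.setVar (by omega) _).exec _, ?_⟩
    have hj' := hA ⟨j, hj⟩
    simp only at hj'
    simp only [Stmt.exec, Expr.eval, Mem.setVar_var, Mem.setVar_arr, ht.var_zero, ht.col, if_true,
      show (0 : ℕ) ≠ 4 by decide, if_false]
    split_ifs with c
    · exact fun _ => ⟨⟨j, hj⟩, by simp, by simp; omega⟩
    · rintro ⟨v, hv, hvA⟩
      rcases Nat.lt_succ_iff_lt_or_eq.1 hv with hv | rfl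
      · simpa using ih ⟨v, hv, hvA⟩
      · omega
  · rintro t ⟨ht, ih⟩
    exact ⟨ht.setVar (by omega) _, by simpa using ih⟩

theorem exec_branch_skip_assign (e f : Expr) (x : ℕ) (s : Mem) :
    ((Stmt.branch e .skip (.assign x f)).exec s).var x =
      if e.eval s = 0 then f.eval s else s.var x := by
  rw [Stmt.exec]
  split_ifs <;> simp [Stmt.exec]

/-- Register 7 is overwritten only by suitable endpoints, so without a suitable edge it keeps the
uncoloured vertex it held. -/
theorem selNeighbor_spec {G : SimpleGraph (Fin m)} (hL : IsEdgeList G L) (h : Ctx n m L A s)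
    (hA : ∀ v : Fin m, A v ≤ n) (h7 : ∃ w : Fin m, s.var 7 = w ∧ A w = n) :
    ∃ w : Fin m, (selNeighbor.exec s).var 7 = w ∧ A w = n ∧
      ((∃ x v : Fin m, G.Adj x v ∧ A x = s.var 6 ∧ A v = n) →
        ∃ x : Fin m, G.Adj x w ∧ A x = s.var 6) := by
  have hadj : ∀ (j : ℕ) (hj : j < L.length), G.Adj L[j].1 L[j].2 := fun j hj => by
    have := (hL.2 s(L[j].1, L[j].2)).1 (List.mem_map_of_mem (List.getElem_mem hj))
    simpa using this
  have := exec_loop_induction (x := 4) (c := .seq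
    (.branch (.add (dist colFst (.var 6)) (.sub (.var 0) colSnd)) .skip
      (.assign 7 (.get 1 (.var 4))))
    (.branch (.add (dist colSnd (.var 6)) (.sub (.var 0) colFst)) .skip
      (.assign 7 (.get 0 (.var 4))))) h.var_two
    (fun j t => Ctx n m L A t ∧ t.var 6 = s.var 6 ∧ ∃ w : Fin m, t.var 7 = w ∧ A w = n ∧
      ((∃ (i : ℕ) (_ : i < j) (hi : i < L.length), (A L[i].1 = s.var 6 ∧ A L[i].2 = n) ∨
        (A L[i].2 = s.var 6 ∧ A L[i].1 = n)) →
        ∃ x : Fin m, G.Adj x w ∧ A x = s.var 6)) ?_ ?_ ?_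
  · obtain ⟨_, _, w, hw, hwA, hw'⟩ := this
    refine ⟨w, hw, hwA, ?_⟩
    rintro ⟨x, v, hxv, hx, hv⟩
    apply hw'
    obtain ⟨e, he, hex⟩ := List.mem_map.1 ((hL.2 s(x, v)).2 (by simpa using hxv))
    obtain ⟨i, hi, rfl⟩ := List.mem_iff_getElem.1 he
    refine ⟨i, hi, hi, ?_⟩
    rcases Sym2.eq_iff.1 hex with ⟨h1, h2⟩ | ⟨h1, h2⟩
    · left; rw [h1, h2]; exact ⟨hx, hv⟩
    · right; rw [h1, h2]; exact ⟨hx, hv⟩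
  · obtain ⟨w, hw, hwA⟩ := h7
    exact ⟨h, rfl, w, hw, hwA, by rintro ⟨i, hi, _⟩; omega⟩
  · rintro j t hj ⟨ht, h6, w, hw, hwA, ih⟩
    refine ⟨(ht.setVar (by omega) _).exec _, ?_, ?_⟩
    · rw [exec_var (by decide)]; simpa using h6
    have h1 := hA L[j].1
    have h2 := hA L[j].2
    have e1 := ht.fst j hj
    have e2 := ht.snd j hj
    set c₁ : Stmt := .branch (.add (dist colFst (.var 6)) (.sub (.var 0) colSnd)) .skip
      (.assign 7 (.get 1 (.var 4))) with hc₁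
    have v0 := exec_var (c := c₁) (x := 0) (by decide) (t.setVar 4 j)
    have v4 := exec_var (c := c₁) (x := 4) (by decide) (t.setVar 4 j)
    have v6 := exec_var (c := c₁) (x := 6) (by decide) (t.setVar 4 j)
    have a0 := exec_arr (c := c₁) (a := 0) (by decide) (t.setVar 4 j)
    have a1 := exec_arr (c := c₁) (a := 1) (by decide) (t.setVar 4 j)
    have a2 := exec_arr (c := c₁) (a := 2) (by decide) (t.setVar 4 j)
    rw [Stmt.exec, exec_branch_skip_assign]
    simp only [Expr.eval, v0, v4, v6, a0, a1, a2]
    rw [hc₁, exec_branch_skip_assign]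
    simp only [Expr.eval,
      Mem.setVar_var, Mem.setVar_arr, if_true, show (0 : ℕ) ≠ 4 by decide,
      show (6 : ℕ) ≠ 4 by decide, show (7 : ℕ) ≠ 4 by decide, if_false, ht.var_zero, ht.col, e1,
      e2, h6]
    split_ifs with c1 c2
    · exact ⟨L[j].1, rfl, by omega, fun _ => ⟨L[j].2, (hadj j hj).symm, by omega⟩⟩
    · exact ⟨L[j].2, rfl, by omega, fun _ => ⟨L[j].1, hadj j hj, by omega⟩⟩
    · refine ⟨w, hw, hwA, ?_⟩
      rintro ⟨i, hi, hiL, hc⟩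
      rcases Nat.lt_succ_iff_lt_or_eq.1 hi with hi | rfl
      · exact ih ⟨i, hi, hiL, hc⟩
      · omega
  · rintro t ⟨ht, h6, ih⟩
    exact ⟨ht.setVar (by omega) _, by simpa using h6, by simpa using ih⟩

/-! ### One greedy step on the machine. -/

/-- Compute the arrays 3, 4, 5. -/
def measure : Stmt := .seq reset (.seq count flags)

/-- Choose the class to extend (register 5) and the class to attach to (register 6). -/
def choose : Stmt := .seq selPoorest (.seq selOpen swapClasses)

/-- Choose the vertex to colour (register 7). -/
def select : Stmt := .seq selUncolored selNeighbor

/-- Colour one more vertex. -/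
def step : Stmt :=
  .seq measure (.seq choose (.seq select (.store 2 (.var 7) (.var 5))))

theorem measure_spec {G : SimpleGraph (Fin m)} [DecidableRel G.Adj] (hL : IsEdgeList G L)
    (h : Ctx n m L A s) (hA : ∀ v : Fin m, A v ≤ n) :
    ∀ c < n, (measure.exec s).arr 3 c = classDeg G (fun v : Fin m => A v) c ∧
      (measure.exec s).arr 4 c = openDeg G n (fun v : Fin m => A v) c ∧
      (measure.exec s).arr 5 c = emptyInd (fun v : Fin m => A v) c := by
  intro c hc
  have h1 : Ctx n m L A (reset.exec s) := h.exec _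
  have h2 : Ctx n m L A (count.exec (reset.exec s)) := h1.exec _
  have hr := reset_spec h
  obtain ⟨h3, h4⟩ := count_spec h1 hA (fun c hc => ⟨(hr c hc).1, (hr c hc).2.1⟩) c hc
  have h5 := flags_spec h2 (fun c hc => by
    rw [exec_arr (by decide)]; exact (hr c hc).2.2) c hc
  rw [measure, Stmt.exec, Stmt.exec, h5, exec_arr (c := flags) (a := 3) (by decide),
    exec_arr (c := flags) (a := 4) (by decide), h3, h4,
    hL.sum_eq fun x _ => if A x = c then 1 else 0,
    hL.sum_eq fun x y => if A x = c ∧ A y = n then 1 else 0]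
  refine ⟨?_, ?_, ?_⟩
  · simp only [classDeg, ite_and]
  · simp only [openDeg, ite_and]
  · have : (∃ v < m, A v = c) ↔ ∃ v : Fin m, A v = c :=
      ⟨fun ⟨v, hv, h⟩ => ⟨⟨v, hv⟩, h⟩, fun ⟨v, h⟩ => ⟨v, v.2, h⟩⟩
    unfold emptyInd
    split_ifs with c1 c2 c2
    exacts [rfl, absurd (this.1 c1) c2, absurd (this.2 c2) c1, rfl]

/-- The three alternatives supply the hypotheses of `GreedyInv.root`, `GreedyInv.step_attach` and
`GreedyInv.step_swap`, in terms of array contents. -/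
theorem choose_spec (h : Ctx n m L A s) (hn : 2 ≤ n) :
    (choose.exec s).var 5 < n ∧
    (((choose.exec s).var 6 = n ∧ (∀ i < n, s.arr 4 i = 0) ∧
      ∀ i < n, s.arr 3 ((choose.exec s).var 5) < s.arr 3 i ∨
        s.arr 3 ((choose.exec s).var 5) = s.arr 3 i ∧ s.arr 4 i + s.arr 5 i ≤
          s.arr 4 ((choose.exec s).var 5) + s.arr 5 ((choose.exec s).var 5)) ∨
    ((choose.exec s).var 6 < n ∧ (choose.exec s).var 6 ≠ (choose.exec s).var 5 ∧
      0 < s.arr 4 ((choose.exec s).var 6) ∧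
      (∀ i < n, i ≠ (choose.exec s).var 5 → s.arr 4 i ≤ s.arr 4 ((choose.exec s).var 6)) ∧
      ∀ i < n, s.arr 3 ((choose.exec s).var 5) < s.arr 3 i ∨
        s.arr 3 ((choose.exec s).var 5) = s.arr 3 i ∧ s.arr 4 i + s.arr 5 i ≤
          s.arr 4 ((choose.exec s).var 5) + s.arr 5 ((choose.exec s).var 5)) ∨
    ((choose.exec s).var 6 < n ∧ (choose.exec s).var 5 ≠ (choose.exec s).var 6 ∧
      0 < s.arr 4 ((choose.exec s).var 6) ∧
      (∀ i < n, i ≠ (choose.exec s).var 6 → s.arr 4 i = 0) ∧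
      (∀ i < n, s.arr 3 ((choose.exec s).var 6) ≤ s.arr 3 i) ∧
      ∀ i < n, i ≠ (choose.exec s).var 6 → s.arr 3 ((choose.exec s).var 5) ≤ s.arr 3 i)) := by
  obtain ⟨hk, hmin⟩ := selPoorest_spec h (by omega)
  have h1 : Ctx n m L A (selPoorest.exec s) := h.exec _
  have h2 : Ctx n m L A (selOpen.exec (selPoorest.exec s)) := h1.exec _
  obtain ⟨hu, hc⟩ := selOpen_spec h1
  rw [exec_arr (c := selPoorest) (a := 4) (by decide)] at hu hc
  have e5 := exec_var (c := selOpen) (x := 5) (by decide) (selPoorest.exec s)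
  have e3 := (exec_arr (c := selOpen) (a := 3) (by decide) (selPoorest.exec s)).trans
    (exec_arr (c := selPoorest) (a := 3) (by decide) s)
  rw [choose, Stmt.exec, Stmt.exec]
  generalize selOpen.exec (selPoorest.exec s) = t at *
  rw [← e5] at hk hmin hc
  simp only [swapClasses, Stmt.exec, Expr.eval, h2.var_zero, hu _ hk]
  split_ifs with c1 c2
  · have h6 : t.var 6 = n := by
      rcases hc with hc | hc <;> omega
    have hz := (hc.resolve_right (by omega)).2
    refine ⟨hk, Or.inl ⟨h6, fun i hi => ?_, hmin⟩⟩
    by_cases hik : i = t.var 5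
    · rw [hik, c2]
    · exact hz i hi hik
  · have h6 : t.var 6 = n := by
      rcases hc with hc | hc <;> omega
    have hz := (hc.resolve_right (by omega)).2
    have hs := selOther_spec (h2.setVar (x := 6) (by omega) (t.var 5)) hn
    rw [exec_var (c := selOther) (x := 6) (by decide)]
    simp only [Mem.setVar_var, Mem.setVar_arr, if_true, e3] at hs ⊢
    refine ⟨hs.1, Or.inr (Or.inr ⟨hk, hs.2.1, by omega, hz, fun i hi => ?_, hs.2.2⟩)⟩
    have := hmin i hi
    omega
  · have := hc.resolve_left (by omega)
    exact ⟨hk, Or.inr (Or.inl ⟨this.1, this.2.1, this.2.2.1, this.2.2.2, hmin⟩)⟩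

theorem select_spec {G : SimpleGraph (Fin m)} (hL : IsEdgeList G L) (h : Ctx n m L A s)
    (hA : ∀ v : Fin m, A v ≤ n) (hex : ∃ v : Fin m, A v = n) :
    ∃ w : Fin m, (select.exec s).var 7 = w ∧ A w = n ∧
      ((∃ x v : Fin m, G.Adj x v ∧ A x = s.var 6 ∧ A v = n) →
        ∃ x : Fin m, G.Adj x w ∧ A x = s.var 6) := by
  have := selNeighbor_spec hL (h.exec selUncolored) hA (selUncolored_spec h hA hex)
  rwa [exec_var (c := selUncolored) (x := 6) (by decide)] at this

theorem step_spec {G : SimpleGraph (Fin m)} [DecidableRel G.Adj] (hG : G.IsAcyclic)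
    (hL : IsEdgeList G L) (h : Ctx n m L A s) (hn : 2 ≤ n)
    (hA : GreedyInv G n fun v : Fin m => A v) (hex : ∃ v : Fin m, A v = n) :
    ∃ (w : Fin m) (k : ℕ), k < n ∧ A w = n ∧ Ctx n m L (Function.update A w k) (step.exec s) ∧
      GreedyInv G n (Function.update (fun v : Fin m => A v) w k) := by
  have h1 : Ctx n m L A (measure.exec s) := h.exec _
  have h2 : Ctx n m L A (choose.exec (measure.exec s)) := h1.exec _
  have h3 : Ctx n m L A (select.exec (choose.exec (measure.exec s))) := h2.exec _
  obtain ⟨w, hw, hwA, hw'⟩ := select_spec hL h2 hA.le hex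
  have hm := measure_spec hL h hA.le
  obtain ⟨hk, hc⟩ := choose_spec h1 hn
  have e5 := exec_var (c := select) (x := 5) (by decide) (choose.exec (measure.exec s))
  rw [step, Stmt.exec, Stmt.exec, Stmt.exec, Stmt.exec]
  simp only [Expr.eval, hw, e5]
  generalize select.exec (choose.exec (measure.exec s)) = t' at *
  generalize choose.exec (measure.exec s) = t at *
  generalize measure.exec s = r at *
  refine ⟨w, t.var 5, hk, hwA, ⟨h3.var_zero, h3.var_one, h3.var_two, ?_, ?_, ?_⟩, ?_⟩
  · simpa using h3.fst
  · simpa using h3.snd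
  · funext i
    simp [Function.update_apply, h3.col]
  have hpoor : (∀ i < n, r.arr 3 (t.var 5) < r.arr 3 i ∨ r.arr 3 (t.var 5) = r.arr 3 i ∧
      r.arr 4 i + r.arr 5 i ≤ r.arr 4 (t.var 5) + r.arr 5 (t.var 5)) →
      ∀ i < n, classDeg G (fun v : Fin m => A v) (t.var 5) < classDeg G (fun v : Fin m => A v) i ∨
        classDeg G (fun v : Fin m => A v) (t.var 5) = classDeg G (fun v : Fin m => A v) i ∧
        openDeg G n (fun v : Fin m => A v) i + emptyInd (fun v : Fin m => A v) i ≤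
          openDeg G n (fun v : Fin m => A v) (t.var 5) +
            emptyInd (fun v : Fin m => A v) (t.var 5) := by
    intro hp i hi
    obtain ⟨a, b, c⟩ := hm i hi
    obtain ⟨a', b', c'⟩ := hm _ hk
    rw [← a, ← b, ← c, ← a', ← b', ← c']
    exact hp i hi
  rcases hc with ⟨_, hz, hp⟩ | ⟨h6, h65, hpos, hmax, hp⟩ | ⟨h6, h56, hpos, hz, hmin, hmin'⟩
  · have hp' := hpoor hp
    refine hA.root hk (fun i hi => ?_) hwA (fun i hi => ?_) (GreedyInv.fill_of_min hp')
    · have := hp' i hi; omega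
    · rw [← (hm i hi).2.1, hz i hi]
  · obtain ⟨x, v, hxv, hx, hv⟩ := exists_adj_of_openDeg_pos ((hm _ h6).2.1 ▸ hpos)
    obtain ⟨x, hxw, hx⟩ := hw' ⟨x, v, hxv, hx, hv⟩
    refine hA.step_attach hG hk h6 h65 (hpoor hp) (fun i hi hik => ?_) hwA hxw hx
    rw [← (hm i hi).2.1, ← (hm _ h6).2.1]
    exact hmax i hi hik
  · obtain ⟨x, v, hxv, hx, hv⟩ := exists_adj_of_openDeg_pos ((hm _ h6).2.1 ▸ hpos)
    obtain ⟨x, hxw, hx⟩ := hw' ⟨x, v, hxv, hx, hv⟩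
    refine hA.step_swap hG h6 hk h56 (fun i hi => ?_) (fun i hi hi6 => ?_) (fun i hi hi6 => ?_)
      hwA hxw hx
    · rw [← (hm i hi).1, ← (hm _ h6).1]; exact hmin i hi
    · rw [← (hm i hi).2.1]; exact hz i hi hi6
    · rw [← (hm i hi).1, ← (hm _ hk).1]; exact hmin' i hi hi6

/-! ### The whole program and its time bound. -/

/-- The greedy algorithm. -/
def greedy : Stmt := .seq initCol (.loop 8 1 step)

theorem greedy_spec {G : SimpleGraph (Fin m)} [DecidableRel G.Adj] (hG : G.IsAcyclic)
    (hL : IsEdgeList G L) (h : Ctx n m L A s) (hn : 2 ≤ n) :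
    ∃ A', (greedy.exec s).arr 2 = A' ∧ GreedyInv G n (fun v : Fin m => A' v) ∧
      ∀ v : Fin m, A' v < n := by
  obtain ⟨A₀, h0, hA₀⟩ := initCol_spec h
  have : ∃ A', Ctx n m L A' (greedy.exec s) ∧ GreedyInv G n (fun v : Fin m => A' v) ∧
      #{v : Fin m | A' v = n} + m = m := by
    -- Each round colours exactly one vertex, so `m` rounds colour all.
    refine exec_loop_induction (x := 8) (c := step) h0.var_one
      (fun j s => ∃ A', Ctx n m L A' s ∧ GreedyInv G n (fun v : Fin m => A' v) ∧
        #{v : Fin m | A' v = n} + j = m) ?_ ?_ ?_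
    · have hA₀' : ∀ v : Fin m, A₀ v = n := fun v => hA₀ v v.2
      refine ⟨A₀, h0, GreedyInv.start hn hA₀', ?_⟩
      rw [filter_true_of_mem fun v _ => hA₀' v]
      simp
    · rintro j s hj ⟨A', hs, hA', hcard⟩
      have hex : ∃ v : Fin m, A' v = n := by
        obtain ⟨v, hv⟩ : Finset.Nonempty {v : Fin m | A' v = n} := card_pos.1 (by omega)
        exact ⟨v, by simpa using hv⟩
      obtain ⟨w, k, hk, hw, hs', hk'⟩ :=
        step_spec hG hL (hs.setVar (x := 8) (by omega) j) hn hA' hex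
      have hupd : (fun v : Fin m => Function.update A' w k v) =
          Function.update (fun v : Fin m => A' v) w k := by
        funext v
        simp [Function.update_apply, Fin.ext_iff]
      refine ⟨_, hs', by rwa [hupd], ?_⟩
      have := card_uncolored_update (col := fun v : Fin m => A' v) hw hk
      simp only [← hupd] at this
      omega
    · rintro s ⟨A', hs, hA', hcard⟩
      exact ⟨A', hs.setVar (by omega) _, hA', hcard⟩
  obtain ⟨A', hs, hA', hcard⟩ := this
  refine ⟨A', hs.col, hA', fun v => (hA'.le v).lt_of_ne fun hv => ?_⟩
  have : #{v : Fin m | A' v = n} = 0 := by omega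
  rw [card_eq_zero, filter_eq_empty_iff] at this
  exact this (mem_univ v) hv

/-- Give each vertex to an agent of its own. -/
def singles : Stmt := .loop 4 1 (.store 2 (.var 4) (.var 4))

theorem singles_spec (h : s.var 1 = m) : ∀ v < m, (singles.exec s).arr 2 v = v := by
  refine exec_loop_induction h (fun j s => ∀ v < j, s.arr 2 v = v) (by simp) ?_ fun _ h => h
  intro j s _ ih v hv
  by_cases hvj : v = j
  · simp [Stmt.exec, Expr.eval, hvj]
  · simpa [Stmt.exec, Expr.eval, hvj] using ih v (by omega)

theorem ctx_inputMem (n : ℕ) (L : List (Fin m × Fin m)) :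
    Ctx n m L (fun _ => 0) (inputMem n m L) := by
  refine ⟨rfl, rfl, rfl, fun j hj => ?_, fun j hj => ?_, rfl⟩ <;> simp [inputMem, hj]

theorem outputs_ofColoring {n m : ℕ} (s : Mem) :
    Outputs s (ofColoring n fun v : Fin m => s.arr 2 v) := by
  intro i o
  simp [ofColoring]

/-- The whole algorithm. -/
def fairDivision : Program :=
  .branch (.sub (.var 1) (.var 0))
    (.branch (.sub (.var 0) (.lit 1)) greedy.compile .skip) singles.compile

/-- If `m ≤ n`, singletons avoid loops of length `n`; otherwise `m * m + m` bounds `n`, `m` and the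
number of edges. For `n = 1 < m` the zero-initialised array 2 is already the answer, and the two
tests and the `skip` cost the constant 9. -/
theorem fairDivision_spec (n m : ℕ) (G : SimpleGraph (Fin m)) [DecidableRel G.Adj]
    (L : List (Fin m × Fin m)) (hn : 1 ≤ n) (hG : G.IsAcyclic) (hL : IsEdgeList G L) :
    ∃ (s : Mem) (t : ℕ), Exec fairDivision (inputMem n m L) s t ∧
      t ≤ 9 + singles.time.eval m + greedy.time.eval (m * m + m) ∧
      ∃ A : Allocation (Fin m) n, Outputs s A ∧ A.IsComplete ∧ A.IsEF1 G ∧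
        A.IsSociallyOptimal G ∧ (n ≤ m → A.IsNonempty) := by
  have hctx := ctx_inputMem n L
  by_cases hnm : m ≤ n
  · obtain ⟨t, ht, hrun⟩ := compile_exec (bs := [1]) (c := singles) (by decide) (M := m)
      (s := inputMem n m L) (by simp [hctx.var_one])
    refine ⟨_, _, .branch_false (by simp [Expr.eval, hctx.var_zero, hctx.var_one, hnm]) hrun,
      by simp only [Expr.cost]; omega, _, outputs_ofColoring _, ?_⟩
    have hs : (fun v : Fin m => (singles.exec (inputMem n m L)).arr 2 v) = fun v : Fin m => (v : ℕ) :=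
      funext fun v : Fin m => singles_spec hctx.var_one v v.2
    rw [hs]
    simpa using ofColoring_injective_spec (G := G) (n := n) (col := fun v : Fin m => (v : ℕ))
      (fun v => by omega) Fin.val_injective (by simpa using hnm)
  rcases hn.eq_or_lt with rfl | hn
  · refine ⟨_, _, .branch_true ?_ (.branch_false ?_ (.skip _)), by simp only [Expr.cost]; omega,
      _, outputs_ofColoring _, ?_⟩
    · simp [Expr.eval, hctx.var_zero, hctx.var_one]; omega
    · simp [Expr.eval, hctx.var_zero]
    · simpa using ofColoring_one_spec (G := G)
        (col := fun v : Fin m => (inputMem 1 m L).arr 2 v) fun v => by rw [hctx.col]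
  · have hlen := hL.length_le
    obtain ⟨t, ht, hrun⟩ := compile_exec (bs := [0, 1, 2]) (c := greedy) (by decide)
      (M := m * m + m) (s := inputMem n m L) (by
        simp only [List.mem_cons, List.not_mem_nil, or_false]
        rintro y (rfl | rfl | rfl)
        · rw [hctx.var_zero]; omega
        · rw [hctx.var_one]; omega
        · rw [hctx.var_two]; omega)
    refine ⟨_, _, .branch_true ?_ (.branch_true ?_ hrun), by simp only [Expr.cost]; omega,
      _, outputs_ofColoring _, ?_⟩
    · simp [Expr.eval, hctx.var_zero, hctx.var_one]; omega
    · simp [Expr.eval, hctx.var_zero]; omega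
    · obtain ⟨A', rfl, hA', hlt⟩ := greedy_spec hG hL hctx hn
      simpa using hA'.ofColoring_spec hlt

end CutDivision

theorem mainTheorem4 :
    (∀ (V : Type*) [Fintype V] [DecidableEq V] (G : SimpleGraph V) [DecidableRel G.Adj] (n : ℕ),
      1 ≤ n → G.IsAcyclic →
        ∃ A : CutDivision.Allocation V n,
          A.IsComplete ∧ A.IsEF1 G ∧ A.IsSociallyOptimal G ∧
            (n ≤ Fintype.card V → A.IsNonempty)) ∧
    (∃ (c : RAM.Program) (p : Polynomial ℕ),
      ∀ (n m : ℕ) (G : SimpleGraph (Fin m)) [DecidableRel G.Adj] (L : List (Fin m × Fin m)),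
        1 ≤ n → G.IsAcyclic → CutDivision.IsEdgeList G L →
          ∃ (s : RAM.Mem) (t : ℕ),
            RAM.Exec c (CutDivision.inputMem n m L) s t ∧ t ≤ p.eval m ∧
            ∃ A : CutDivision.Allocation (Fin m) n,
              CutDivision.Outputs s A ∧
              A.IsComplete ∧ A.IsEF1 G ∧ A.IsSociallyOptimal G ∧
                (n ≤ m → A.IsNonempty)) := by
  refine ⟨fun V _ _ G _ n hn hG => CutDivision.exists_fair_optimal hG hn,
    CutDivision.fairDivision, 9 + CutDivision.singles.time +
      CutDivision.greedy.time.comp (Polynomial.X * Polynomial.X + Polynomial.X),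
    fun n m G _ L hn hG hL => ?_⟩
  simpa using CutDivision.fairDivision_spec n m G L hn hG hL
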